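/- All families below are families of subsets of a topological space $X$. A family is *discrete* if every point of $X$ has a neighbourhood meeting at most one of its members; a family $\mathcal V$ *refines* $\mathcal U$ if every member of $\mathcal V$ is contained in a member of $\mathcal U$. Let $\mathcal O$ be the collection of all open covers of $X$ and, for $Y\subseteq X$, let $\mathcal O_Y$ be the collection of all covers of $Y$ by sets open in $X$. In the game $\mathsf G_d^\omega(\mathcal O,\mathcal O_Y)$ player ONE chooses in inning $n<\omega$ a family $A_n\in\mathcal O$ and player TWO answers with a discrete family $B_n$ refining $A_n$; TWO wins if $\bigcup_{n<\omega}B_n\in\mathcal O_Y$, and otherwise ONE wins. A space is *zero-dimensional* if every point has a neighbourhood basis of clopen sets. It has *covering dimension at most $n$* if every finite open cover has an open refinement that is still a cover and is such that every point lies in at most $n+1$ of its members. It is *strongly zero-dimensional* if every finite open cover has a refinement by pairwise disjoint open sets that still covers the space (equivalently, if it has covering dimension at most $0$). Let $D(\aleph_1)$ be the discrete space of cardinality $\aleph_1$. A *Kulesza space* is a complete, zero-dimensional metric space $K$ of covering dimension exactly $1$ (at most $1$ but not at most $0$), together with a representation $K=P_1\cup\bigcup_{m\in\mathbb N}P_2^m$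 in which the subspace $P_1$ is homeomorphic to $D(\aleph_1)^\omega$ and each $P_2^m$ is a closed, nowhere dense, strongly zero-dimensional subspace of $K$. **Corollary.** Kulesza spaces exist, and on every Kulesza space $K=P_1\cup\bigcup_{m\in\mathbb N}P_2^m$ player TWO has no winning strategy in the game $\mathsf G_d^\omega(\mathcal O,\mathcal O_{P_1})$. -/

import Mathlib

open Set Topology

universe u

/-- A family `𝒜` of subsets is discrete if every point has a neighbourhood meeting at most one
member of `𝒜`. -/
def IsDiscreteFamily {X : Type*} [TopologicalSpace X] (𝒜 : Set (Set X)) : Prop :=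
  ∀ x : X, ∃ U ∈ 𝓝 x, {A ∈ 𝒜 | (A ∩ U).Nonempty}.Subsingleton

/-- `𝒜` refines `ℬ`: every member of `𝒜` is contained in some member of `ℬ`. -/
def Refines {X : Type*} (𝒜 ℬ : Set (Set X)) : Prop :=
  ∀ A ∈ 𝒜, ∃ B ∈ ℬ, A ⊆ B

/-- `𝒪_Y`: the covers of the subset `Y` of `X` by sets open in `X`. -/
def openCoversOf {X : Type*} [TopologicalSpace X] (Y : Set X) : Set (Set (Set X)) :=
  {𝒰 | (∀ U ∈ 𝒰, IsOpen U) ∧ Y ⊆ ⋃₀ 𝒰}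

/-- `𝒪`: the open covers of `X`. -/
def openCovers (X : Type*) [TopologicalSpace X] : Set (Set (Set X)) :=
  openCoversOf (univ : Set X)

/-- The reply made in inning `n` by a player TWO who follows the strategy `F` against the moves
`A 0, A 1, …` of player ONE. A strategy of TWO with perfect information sees the moves
`A 0, …, A n` of ONE (TWO's own earlier moves are determined by them). -/
def replyTwo {X : Type*} (F : List (Set (Set X)) → Set (Set X)) (A : ℕ → Set (Set X)) (n : ℕ) :
    Set (Set X) :=
  F ((List.range (n + 1)).map A)

/-- `F` is a winning strategy for TWO in the game `G_d^ω(𝒜, ℬ)`: against all moves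
`A 0, A 1, … ∈ 𝒜` of ONE, each reply is a discrete family refining ONE's move of that inning, and
the union of all replies is an element of `ℬ`. -/
def IsWinningStrategyTwo {X : Type*} [TopologicalSpace X] (𝒜 ℬ : Set (Set (Set X)))
    (F : List (Set (Set X)) → Set (Set X)) : Prop :=
  ∀ A : ℕ → Set (Set X), (∀ n, A n ∈ 𝒜) →
    (∀ n, IsDiscreteFamily (replyTwo F A n) ∧ Refines (replyTwo F A n) (A n)) ∧
      (⋃ n, replyTwo F A n) ∈ ℬ

/-- TWO has a winning strategy in the game `G_d^ω(𝒜, ℬ)`. -/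
def TwoHasWinningStrategy {X : Type*} [TopologicalSpace X] (𝒜 ℬ : Set (Set (Set X))) : Prop :=
  ∃ F : List (Set (Set X)) → Set (Set X), IsWinningStrategyTwo 𝒜 ℬ F

/-- Zero-dimensional: every point has a neighbourhood basis of sets that are open and closed. -/
def IsZeroDimensional (X : Type*) [TopologicalSpace X] : Prop :=
  ∀ x : X, (𝓝 x).HasBasis (fun s : Set X => x ∈ s ∧ IsClopen s) id

/-- Strongly zero-dimensional (covering dimension zero): every finite open cover has a refinement
by pairwise disjoint open sets that still covers the space. -/
def IsStronglyZeroDimensional (X : Type*) [TopologicalSpace X] : Prop :=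
  ∀ 𝒰 ∈ openCovers X, 𝒰.Finite →
    ∃ 𝒱 ∈ openCovers X, Refines 𝒱 𝒰 ∧ 𝒱.PairwiseDisjoint id

/-- Covering dimension at most `n`: every finite open cover has an open refinement, still covering
the space, such that every point lies in at most `n + 1` of its members. -/
def CoveringDimLE (X : Type*) [TopologicalSpace X] (n : ℕ) : Prop :=
  ∀ 𝒰 ∈ openCovers X, 𝒰.Finite →
    ∃ 𝒱 ∈ openCovers X, Refines 𝒱 𝒰 ∧ ∀ x : X, {V ∈ 𝒱 | x ∈ V}.encard ≤ n + 1

theorem coveringDimLE_zero_iff (X : Type*) [TopologicalSpace X] :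
    CoveringDimLE X 0 ↔ IsStronglyZeroDimensional X := by
  unfold CoveringDimLE IsStronglyZeroDimensional
  refine forall₃_congr fun 𝒰 _ _ => exists_congr fun 𝒱 => and_congr_right fun _ =>
    and_congr_right fun _ => ?_
  simp only [Nat.cast_zero, zero_add, Set.encard_le_one_iff]
  constructor
  · intro h V hV W hW hne
    refine Set.disjoint_left.2 fun x hxV hxW => hne (h x V W ⟨hV, hxV⟩ ⟨hW, hxW⟩)
  · rintro h x V W ⟨hV, hxV⟩ ⟨hW, hxW⟩
    by_contra hne
    exact Set.disjoint_left.1 (h hV hW hne) hxV hxW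

/-- The discrete space `D(ℵ₁)` of cardinality `ℵ₁`. -/
def DiscreteAlephOne : Type := (Cardinal.aleph.{0} 1).out

instance : TopologicalSpace DiscreteAlephOne := ⊥

instance : DiscreteTopology DiscreteAlephOne := ⟨rfl⟩

theorem mk_discreteAlephOne : Cardinal.mk DiscreteAlephOne = Cardinal.aleph 1 :=
  Cardinal.mk_out _

/-- The metric space `K` with the subsets `P₁` and `P₂ m` (`m ∈ ℕ`) is a Kulesza space: it is
complete, zero-dimensional, of covering dimension exactly one, and it is the union of a subspace
`P₁` homeomorphic to `D(ℵ₁)^ω` and of countably many closed, nowhere dense, strongly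
zero-dimensional subspaces `P₂ m`. -/
structure IsKuleszaSpace (K : Type*) [MetricSpace K] (P₁ : Set K) (P₂ : ℕ → Set K) : Prop where
  complete : CompleteSpace K
  zeroDimensional : IsZeroDimensional K
  coveringDim_le_one : CoveringDimLE K 1
  not_coveringDim_le_zero : ¬ CoveringDimLE K 0
  eq_union : P₁ ∪ ⋃ m, P₂ m = univ
  homeo : Nonempty (P₁ ≃ₜ (ℕ → DiscreteAlephOne))
  isClosed : ∀ m, IsClosed (P₂ m)
  isNowhereDense : ∀ m, IsNowhereDense (P₂ m)
  stronglyZeroDimensional : ∀ m, IsStronglyZeroDimensional (P₂ m)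

/-!
**No winning strategy.** Suppose that TWO wins the game for `P₁`. Let ONE play only covers by balls
of radius `1 / (n + 1)`. For each finite sequence of such moves, the points that TWO would cover, up
to closure, in the next inning, whichever of these covers ONE plays, form a closed set; since the
replies are discrete families of arbitrarily small mesh, this set is strongly zero-dimensional. A
point of `P₁` outside all these countably many sets could be kept uncovered by ONE forever, so they
cover `P₁` (`TwoHasWinningStrategy.exists_cover`). Together with the sets `P₂ m` they cover the
whole space, and the countable closed sum theorem (`isStronglyZeroDimensional_of_isClosedEmbedding`) makes
it strongly zero-dimensional, which a Kulesza space is not.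

**Existence.** Let `Ω` be a set of cardinality `ℵ₁` and `e : Ω → Ω → ℕ` a function unbounded on
every product of two uncountable sets (`exists_unbounded_weight`). The space has a tree of clopen
cells. Think of each cell as a fat interval: it has end points `left`, `mid`, `right`, each in as
many copies as there are sequences `f : ℕ → Ω`. A child of a cell is given by a half of the cell
and two letters `ξ`, `η`; it occupies this half in such a way that its own left and right end points
with sequence `g` are close to the end points with sequences `ξ :: g` and `η :: g` that bound the
half. How close is measured by the weight `e ξ η`. The points of the space are the branches of the
tree, which form a copy of `Ω^ω`, and the end points.

Nearness at level `N` identifies end points joined by attachments of weight at least `N`, neglects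
letters beyond level `N`, and makes a cell of level `N` a single edge between the classes to which
it is attached. Since each half of a cell is bounded by a middle end point, which is attached to
nothing further up, the stars of level `N + 1` star-refine those of level `N`
(`exists_star_subset`). This gives a complete metric.

The space is zero-dimensional because high-level stars of end points are clopen
(`isClopen_star`): the edges at a star whose other ends accumulate at one point would have
determined letters, and so bounded weight. It has dimension at most one as the union of two
strongly zero-dimensional sets, the branches and the end points. It is not strongly
zero-dimensional: call a set of sequences null if countable sets of letters can be assigned to all
finite sequences so that every member of the set at some time picks an assigned letter. If a clopen
set contains non-null many left end points of a cell and misses non-null many of its right end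
points, then, depending on how it meets the middle end points, the same holds for one half of the
cell and, as `e` is unbounded on products of uncountable sets, for some child in this half
(`Separates.exists_cons`). Iterating yields a branch in the closure of both the clopen set and its
complement.
-/

/-! ### Strongly zero-dimensional spaces -/

/-- A sequence of equivalence relations with open classes, the classes forming neighbourhood bases,
makes a space strongly zero-dimensional: given a cover, take at each point the class of the least
level that is contained in a member of the cover. -/
theorem isStronglyZeroDimensional_of_setoid {X : Type*} [TopologicalSpace X] (r : ℕ → Setoid X)
    (hopen : ∀ n x, {y | r n x y} ∈ 𝓝 x)
    (hbasis : ∀ x, ∀ U ∈ 𝓝 x, ∃ n, {y | r n x y} ⊆ U) : IsStronglyZeroDimensional X := by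
  intro 𝒰 h𝒰 _
  let R : ℕ → Setoid X := fun n =>
    { r := fun x y => ∀ k ≤ n, r k x y
      iseqv := ⟨fun x k _ => (r k).refl x, fun h k hk => (r k).symm (h k hk),
        fun h h' k hk => (r k).trans (h k hk) (h' k hk)⟩ }
  have hRopen : ∀ n x, IsOpen {y | R n x y} := fun n x => isOpen_iff_mem_nhds.2 fun y hy => by
    have h : (⋂ k ∈ Iic n, {z | r k y z}) ∈ 𝓝 y :=
      (Filter.biInter_mem (finite_Iic n)).2 fun k _ => hopen k y
    refine Filter.mem_of_superset h fun z hz => (R n).trans hy fun k hk => ?_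
    exact mem_iInter₂.1 hz k hk
  have hRanti : ∀ {m n x y}, m ≤ n → R n x y → R m x y := fun hmn h k hk => h k (hk.trans hmn)
  have hgood : ∀ x, ∃ n, ∃ U ∈ 𝒰, {y | R n x y} ⊆ U := fun x => by
    obtain ⟨U, hU, hx⟩ := h𝒰.2 (mem_univ x)
    obtain ⟨n, hn⟩ := hbasis x U ((h𝒰.1 U hU).mem_nhds hx)
    exact ⟨n, U, hU, fun y hy => hn (hy n le_rfl)⟩
  classical
  let ν : X → ℕ := fun x => Nat.find (hgood x)
  have hν : ∀ x, ∃ U ∈ 𝒰, {y | R (ν x) x y} ⊆ U := fun x => Nat.find_spec (hgood x)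
  have heq : ∀ x x', ν x ≤ ν x' → R (ν x) x x' → {y | R (ν x) x y} = {y | R (ν x') x' y} := by
    intro x x' hle h
    have hle' : ν x' ≤ ν x := by
      obtain ⟨U, hU, hxU⟩ := hν x
      exact Nat.find_min' (hgood x') ⟨U, hU, fun y hy => hxU ((R _).trans h hy)⟩
    rw [← le_antisymm hle hle']
    ext y
    exact ⟨fun hy => (R _).trans ((R _).symm h) hy, fun hy => (R _).trans h hy⟩
  refine ⟨range fun x => {y | R (ν x) x y}, ⟨?_, fun x _ => ⟨_, ⟨x, rfl⟩, (R _).refl x⟩⟩, ?_, ?_⟩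
  · rintro _ ⟨x, rfl⟩
    exact hRopen _ x
  · rintro _ ⟨x, rfl⟩
    exact hν x
  · rintro _ ⟨x, rfl⟩ _ ⟨x', rfl⟩ hne
    refine disjoint_left.2 fun z hz hz' => hne ?_
    rcases le_total (ν x) (ν x') with h | h
    · exact heq x x' h ((R _).trans hz ((R _).symm (hRanti h hz')))
    · exact (heq x' x h ((R _).trans hz' ((R _).symm (hRanti h hz)))).symm

/-- Disjoint closed subsets of a strongly zero-dimensional space are separated by a clopen set. -/
theorem IsStronglyZeroDimensional.exists_isClopen {X : Type*} [TopologicalSpace X]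
    (hX : IsStronglyZeroDimensional X) {A B : Set X} (hA : IsClosed A) (hB : IsClosed B)
    (hAB : Disjoint A B) : ∃ C, IsClopen C ∧ A ⊆ C ∧ Disjoint C B := by
  obtain ⟨𝒱, ⟨hVo, hVc⟩, hVr, hVd⟩ := hX {Aᶜ, Bᶜ} ⟨by
      rintro U (rfl | rfl)
      exacts [hA.isOpen_compl, hB.isOpen_compl], fun x _ => by
      by_cases hx : x ∈ A
      · exact ⟨Bᶜ, by simp, disjoint_left.1 hAB hx⟩
      · exact ⟨Aᶜ, by simp, hx⟩⟩ (by simp)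
  refine ⟨⋃₀ {V ∈ 𝒱 | (V ∩ A).Nonempty}, ⟨?_, isOpen_sUnion fun V hV => hVo V hV.1⟩, ?_, ?_⟩
  · have : (⋃₀ {V ∈ 𝒱 | (V ∩ A).Nonempty})ᶜ = ⋃₀ {V ∈ 𝒱 | ¬ (V ∩ A).Nonempty} := by
      ext x
      constructor
      · intro hx
        obtain ⟨V, hV, hxV⟩ := hVc (mem_univ x)
        exact ⟨V, ⟨hV, fun h => hx ⟨V, ⟨hV, h⟩, hxV⟩⟩, hxV⟩
      · rintro ⟨V, ⟨hV, hVA⟩, hxV⟩ ⟨W, ⟨hW, hWA⟩, hxW⟩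
        have hne : V ≠ W := fun h => hVA (h ▸ hWA)
        exact disjoint_left.1 (hVd hV hW hne) hxV hxW
    rw [← isOpen_compl_iff, this]
    exact isOpen_sUnion fun V hV => hVo V hV.1
  · intro x hx
    obtain ⟨V, hV, hxV⟩ := hVc (mem_univ x)
    exact ⟨V, ⟨hV, x, hxV, hx⟩, hxV⟩
  · rw [disjoint_left]
    rintro x ⟨V, ⟨hV, y, hyV, hyA⟩, hxV⟩ hxB
    obtain ⟨U, rfl | rfl, hVU⟩ := hVr V hV
    · exact hVU hyV hyA
    · exact hVU hxV hxB

theorem isStronglyZeroDimensional_of_exists_isClopen {X : Type*} [TopologicalSpace X]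
    [NormalSpace X] (h : ∀ A B : Set X, IsClosed A → IsClosed B → Disjoint A B →
      ∃ C, IsClopen C ∧ A ⊆ C ∧ Disjoint C B) : IsStronglyZeroDimensional X := by
  intro 𝒰 h𝒰 hfin
  obtain ⟨n, u, -, hu⟩ := hfin.fin_param
  subst hu
  obtain ⟨v, hv, hvc, hvu⟩ := exists_iUnion_eq_closed_subset (u := u)
    (fun i => h𝒰.1 _ ⟨i, rfl⟩) (fun x => Set.toFinite _)
    (univ_subset_iff.1 (by rw [← sUnion_range]; exact h𝒰.2))
  choose C hC hvC hCu using fun i => h (v i) (u i)ᶜ (hvc i) (h𝒰.1 _ ⟨i, rfl⟩).isClosed_compl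
    (disjoint_compl_right_iff_subset.2 (hvu i))
  have hCu' : ∀ i, C i ⊆ u i := fun i => disjoint_compl_right_iff_subset.1 (hCu i)
  let W : Fin n → Set X := fun i => C i \ ⋃ j < i, C j
  refine ⟨range W, ⟨?_, fun x _ => ?_⟩, ?_, ?_⟩
  · rintro _ ⟨i, rfl⟩
    refine (hC i).isOpen.sdiff ?_
    exact (Set.toFinite {j | j < i}).isClosed_biUnion fun j _ => (hC j).isClosed
  · obtain ⟨i, hi⟩ : ∃ i, x ∈ C i := by
      obtain ⟨i, hi⟩ := mem_iUnion.1 (hv.symm ▸ mem_univ x)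
      exact ⟨i, hvC i hi⟩
    obtain ⟨m, hm, hmin⟩ := WellFounded.has_min (wellFounded_lt (α := Fin n)) {i | x ∈ C i} ⟨i, hi⟩
    refine ⟨W m, ⟨m, rfl⟩, hm, ?_⟩
    simp only [mem_iUnion, not_exists]
    exact fun j hj hxj => hmin j hxj hj
  · rintro _ ⟨i, rfl⟩
    exact ⟨u i, ⟨i, rfl⟩, sdiff_subset.trans (hCu' i)⟩
  · rintro _ ⟨i, rfl⟩ _ ⟨j, rfl⟩ hne
    have aux : ∀ i j, i < j → Disjoint (W i) (W j) := fun i j hij =>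
      disjoint_left.2 fun x hx hx' => hx'.2 (mem_biUnion hij hx.1)
    rcases lt_trichotomy i j with h | rfl | h
    · exact aux i j h
    · exact absurd rfl hne
    · exact (aux j i h).symm

theorem exists_isOpen_disjoint_closure {X : Type*} [TopologicalSpace X] [NormalSpace X]
    {A B : Set X} (hA : IsClosed A) (hB : IsClosed B) (hAB : Disjoint A B) :
    ∃ U V, IsOpen U ∧ IsOpen V ∧ A ⊆ U ∧ B ⊆ V ∧ Disjoint (closure U) (closure V) := by
  obtain ⟨U, hU, hAU, hUB⟩ := normal_exists_closure_subset hA hB.isOpen_compl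
    (disjoint_left.1 hAB)
  obtain ⟨V, hV, hBV, hVU⟩ := normal_exists_closure_subset hB
    (isClosed_closure (s := U)).isOpen_compl (fun x hx h => hUB h hx)
  exact ⟨U, V, hU, hV, hAU, hBV, disjoint_left.2 fun x hx hx' => hVU hx' hx⟩

/-- The countable closed sum theorem in dimension zero. -/
theorem isStronglyZeroDimensional_of_isClosedEmbedding {X : Type*} [TopologicalSpace X]
    [NormalSpace X] {ι : Type*} [Countable ι] {Z : ι → Type*} [∀ i, TopologicalSpace (Z i)]
    (f : ∀ i, Z i → X) (hf : ∀ i, IsClosedEmbedding (f i))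
    (hZ : ∀ i, IsStronglyZeroDimensional (Z i)) (hcov : ⋃ i, range (f i) = univ) :
    IsStronglyZeroDimensional X := by
  refine isStronglyZeroDimensional_of_exists_isClopen fun A B hA hB hAB => ?_
  -- one step: enlarge the two sets so that they cover one more member of the cover
  have step : ∀ i (P Q : Set X), Disjoint (closure P) (closure Q) → ∃ U V, IsOpen U ∧ IsOpen V ∧
      closure P ⊆ U ∧ closure Q ⊆ V ∧ Disjoint (closure U) (closure V) ∧ range (f i) ⊆ U ∪ V := by
    intro i P Q hPQ
    obtain ⟨C, hC, hPC, hCQ⟩ := (hZ i).exists_isClopen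
      (isClosed_closure.preimage (hf i).continuous) (isClosed_closure.preimage (hf i).continuous)
      (hPQ.preimage (f i))
    obtain ⟨U, V, hU, hV, hPU, hQV, hUV⟩ := exists_isOpen_disjoint_closure
      ((isClosed_closure (s := P)).union ((hf i).isClosedMap C hC.isClosed))
      ((isClosed_closure (s := Q)).union ((hf i).isClosedMap Cᶜ hC.compl.isClosed)) (by
        rw [disjoint_left]
        rintro x (hx | ⟨y, hy, rfl⟩) (hx' | ⟨z, hz, hzx⟩)
        · exact disjoint_left.1 hPQ hx hx'
        · subst hzx; exact hz (hPC hx)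
        · exact disjoint_left.1 hCQ hy hx'
        · exact hz ((hf i).injective hzx ▸ hy))
    refine ⟨U, V, hU, hV, subset_union_left.trans hPU, subset_union_left.trans hQV, hUV, ?_⟩
    rintro _ ⟨y, rfl⟩
    by_cases hy : y ∈ C
    · exact .inl (hPU (.inr ⟨y, hy, rfl⟩))
    · exact .inr (hQV (.inr ⟨y, hy, rfl⟩))
  rcases isEmpty_or_nonempty ι with hι | hι
  · have : IsEmpty X := by
      rw [iUnion_of_empty] at hcov
      exact univ_eq_empty_iff.1 hcov.symm
    exact ⟨∅, isClopen_empty, fun x => isEmptyElim x, by simp⟩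
  obtain ⟨enum, henum⟩ := exists_surjective_nat ι
  choose U V hU hV hPU hQV hUV hcov' using step
  let S : ℕ → {p : Set X × Set X // Disjoint (closure p.1) (closure p.2)} := fun n =>
    Nat.rec ⟨(A, B), by simpa [hA.closure_eq, hB.closure_eq] using hAB⟩
      (fun n p => ⟨(U (enum n) p.1.1 p.1.2 p.2, V (enum n) p.1.1 p.1.2 p.2), hUV _ _ _ _⟩) n
  have hS1 : Monotone fun n => (S n).1.1 := monotone_nat_of_le_succ fun n =>
    subset_closure.trans (hPU (enum n) _ _ (S n).2)
  have hS2 : Monotone fun n => (S n).1.2 := monotone_nat_of_le_succ fun n =>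
    subset_closure.trans (hQV (enum n) _ _ (S n).2)
  have hdisj : ∀ m n, Disjoint (S m).1.1 (S n).1.2 := fun m n =>
    ((S (max m n)).2.mono subset_closure subset_closure).mono (hS1 (le_max_left m n))
      (hS2 (le_max_right m n))
  have hopen : ∀ n, IsOpen (S (n + 1)).1.1 ∧ IsOpen (S (n + 1)).1.2 := fun n =>
    ⟨hU (enum n) _ _ (S n).2, hV (enum n) _ _ (S n).2⟩
  have hcompl : (⋃ n, (S (n + 1)).1.1)ᶜ = ⋃ n, (S (n + 1)).1.2 := by
    refine Subset.antisymm (fun x hx => ?_) (fun x hx hx' => ?_)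
    · obtain ⟨i, hi⟩ := mem_iUnion.1 (hcov.symm ▸ mem_univ x)
      obtain ⟨n, rfl⟩ := henum i
      rcases hcov' (enum n) _ _ (S n).2 hi with h | h
      · exact absurd (mem_iUnion.2 ⟨n, h⟩) hx
      · exact mem_iUnion.2 ⟨n, h⟩
    · obtain ⟨n, hn⟩ := mem_iUnion.1 hx
      obtain ⟨m, hm⟩ := mem_iUnion.1 hx'
      exact disjoint_left.1 (hdisj (m + 1) (n + 1)) hm hn
  refine ⟨⋃ n, (S (n + 1)).1.1, ⟨?_, isOpen_iUnion fun n => (hopen n).1⟩, ?_, ?_⟩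
  · rw [← isOpen_compl_iff, hcompl]
    exact isOpen_iUnion fun n => (hopen n).2
  · exact (show A ⊆ _ from hS1 (Nat.zero_le 1)).trans (subset_iUnion (fun n => (S (n + 1)).1.1) 0)
  · rw [disjoint_iUnion_left]
    exact fun n => hdisj (n + 1) 0

/-! ### Spaces of dimension at most one -/

/-- Relatively open sets of a partition of a subspace extend to disjoint open sets. -/
theorem exists_extension_of_isStronglyZeroDimensional {X : Type*} [MetricSpace X] {A : Set X}
    (hA : IsStronglyZeroDimensional A) {𝒰 : Set (Set X)} (h𝒰 : 𝒰 ∈ openCovers X)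
    (hfin : 𝒰.Finite) : ∃ 𝒲 ∈ openCoversOf A, Refines 𝒲 𝒰 ∧
      ∀ x, {W ∈ 𝒲 | x ∈ W}.Subsingleton := by
  obtain ⟨𝒱, ⟨hVo, hVc⟩, hVr, hVd⟩ := hA ((fun U => Subtype.val ⁻¹' U) '' 𝒰) ⟨by
      rintro _ ⟨U, hU, rfl⟩
      exact (h𝒰.1 U hU).preimage continuous_subtype_val, fun x _ => by
      obtain ⟨U, hU, hx⟩ := h𝒰.2 (mem_univ x.1)
      exact ⟨_, ⟨U, hU, rfl⟩, hx⟩⟩ (hfin.image _)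
  have hV : ∀ V ∈ 𝒱, ∃ U ∈ 𝒰, V ⊆ Subtype.val ⁻¹' U := fun V hV => by
    obtain ⟨_, ⟨U, hU, rfl⟩, h⟩ := hVr V hV
    exact ⟨U, hU, h⟩
  choose! u hu hVu using hV
  -- the points closer to `V` than to the rest of the subspace
  let E : Set A → Set X := fun V =>
    {x | Metric.infEDist x (Subtype.val '' V) < Metric.infEDist x (Subtype.val '' Vᶜ)} ∩ u V
  refine ⟨E '' 𝒱, ⟨?_, ?_⟩, ?_, ?_⟩
  · rintro _ ⟨V, hV, rfl⟩
    exact (isOpen_lt Metric.continuous_infEDist Metric.continuous_infEDist).inter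
      (h𝒰.1 _ (hu V hV))
  · intro x hx
    obtain ⟨V, hV, hxV⟩ := hVc (mem_univ (⟨x, hx⟩ : A))
    refine ⟨E V, ⟨V, hV, rfl⟩, ?_, hVu V hV hxV⟩
    have h0 : Metric.infEDist x (Subtype.val '' V) = 0 :=
      Metric.infEDist_zero_of_mem ⟨_, hxV, rfl⟩
    have h1 : x ∉ closure (Subtype.val '' Vᶜ : Set X) := fun h => by
      have : (⟨x, hx⟩ : A) ∈ closure Vᶜ := by
        rw [closure_subtype]; exact h
      rw [(hVo V hV).isClosed_compl.closure_eq] at this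
      exact this hxV
    change Metric.infEDist x _ < Metric.infEDist x _
    rw [h0, pos_iff_ne_zero]
    exact fun h => h1 (Metric.mem_closure_iff_infEDist_zero.2 h)
  · rintro _ ⟨V, hV, rfl⟩
    exact ⟨u V, hu V hV, inter_subset_right⟩
  · rintro x _ ⟨⟨V, hV, rfl⟩, hxV⟩ _ ⟨⟨W, hW, rfl⟩, hxW⟩
    by_contra hne
    have hVW : Disjoint V W := hVd hV hW fun h => hne (by rw [h])
    have h1 : Metric.infEDist x (Subtype.val '' Vᶜ) ≤ Metric.infEDist x (Subtype.val '' W) :=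
      Metric.infEDist_anti (image_mono fun y hy hy' => disjoint_left.1 hVW hy' hy)
    have h2 : Metric.infEDist x (Subtype.val '' Wᶜ) ≤ Metric.infEDist x (Subtype.val '' V) :=
      Metric.infEDist_anti (image_mono fun y hy hy' => disjoint_left.1 hVW hy hy')
    exact lt_irrefl _ (((hxV.1.trans_le h1).trans hxW.1).trans_le h2)

theorem coveringDimLE_one_of_union {X : Type*} [MetricSpace X] {A B : Set X}
    (hA : IsStronglyZeroDimensional A) (hB : IsStronglyZeroDimensional B) (hAB : A ∪ B = univ) :
    CoveringDimLE X 1 := by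
  intro 𝒰 h𝒰 hfin
  obtain ⟨𝒱, hV, hVr, hVd⟩ := exists_extension_of_isStronglyZeroDimensional hA h𝒰 hfin
  obtain ⟨𝒲, hW, hWr, hWd⟩ := exists_extension_of_isStronglyZeroDimensional hB h𝒰 hfin
  refine ⟨𝒱 ∪ 𝒲, ⟨?_, ?_⟩, ?_, fun x => ?_⟩
  · rintro U (hU | hU)
    exacts [hV.1 U hU, hW.1 U hU]
  · rw [← hAB, sUnion_union]
    exact union_subset_union hV.2 hW.2
  · rintro U (hU | hU)
    exacts [hVr U hU, hWr U hU]
  · have : {U ∈ 𝒱 ∪ 𝒲 | x ∈ U} = {U ∈ 𝒱 | x ∈ U} ∪ {U ∈ 𝒲 | x ∈ U} := by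
      ext U; simp [or_and_right]
    rw [this]
    refine (encard_union_le _ _).trans ?_
    exact add_le_add (encard_le_one_iff_subsingleton.2 (hVd x))
      (encard_le_one_iff_subsingleton.2 (hWd x))

/-! ### The game -/

/-- The set of points that the reply `B n` of TWO covers for every `n`, up to closure, is strongly
zero-dimensional if the replies are discrete families of mesh tending to zero. -/
theorem isStronglyZeroDimensional_iInter {X : Type*} [MetricSpace X] (B : ℕ → Set (Set X))
    (hB : ∀ n, IsDiscreteFamily (B n))
    (hmesh : ∀ n, ∀ b ∈ B n, ∃ c, b ⊆ Metric.ball c (1 / (n + 1))) :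
    IsStronglyZeroDimensional (⋂ n, ⋃ b ∈ B n, closure b : Set X) := by
  have huniq : ∀ n x, ∃ U ∈ 𝓝 x, ∀ y ∈ U, ∀ b ∈ B n, ∀ b' ∈ B n, x ∈ closure b → y ∈ closure b' →
      b = b' := by
    intro n x
    obtain ⟨U, hU, hsub⟩ := hB n x
    refine ⟨interior U, interior_mem_nhds.2 hU, fun y hy b hb b' hb' hx hx' => ?_⟩
    refine hsub ⟨hb, ?_⟩ ⟨hb', ?_⟩
    · exact inter_comm U b ▸ mem_closure_iff_nhds.1 hx U hU
    · exact inter_comm U b' ▸ mem_closure_iff_nhds.1 hx' U (mem_interior_iff_mem_nhds.1 hy)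
  have hex : ∀ n (x : ↥(⋂ n, ⋃ b ∈ B n, closure b)), ∃ b ∈ B n, x.1 ∈ closure b := fun n x => by
    simpa using mem_iInter.1 x.2 n
  let r : ℕ → Setoid ↥(⋂ n, ⋃ b ∈ B n, closure b) := fun n =>
    { r := fun x y => ∃ b ∈ B n, x.1 ∈ closure b ∧ y.1 ∈ closure b
      iseqv := by
        refine ⟨fun x => ?_, fun ⟨b, hb, h, h'⟩ => ⟨b, hb, h', h⟩, ?_⟩
        · obtain ⟨b, hb, h⟩ := hex n x
          exact ⟨b, hb, h, h⟩
        · rintro x y z ⟨b, hb, h1, h2⟩ ⟨b', hb', h3, h4⟩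
          obtain ⟨U, hU, hu⟩ := huniq n y
          obtain rfl := hu y (mem_of_mem_nhds hU) b hb b' hb' h2 h3
          exact ⟨b, hb, h1, h4⟩ }
  refine isStronglyZeroDimensional_of_setoid r (fun n x => ?_) (fun x S hS => ?_)
  · obtain ⟨U, hU, hu⟩ := huniq n x.1
    refine Filter.mem_of_superset (continuous_subtype_val.continuousAt.preimage_mem_nhds hU) ?_
    intro y hy
    obtain ⟨b, hb, h⟩ := hex n x
    obtain ⟨b', hb', h'⟩ := hex n y
    obtain rfl := hu y.1 hy b hb b' hb' h h'
    exact ⟨b, hb, h, h'⟩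
  · obtain ⟨ε, hε, hεS⟩ := Metric.mem_nhds_iff.1 hS
    obtain ⟨n, hn⟩ := exists_nat_one_div_lt (half_pos hε)
    refine ⟨n, fun y ⟨b, hb, h, h'⟩ => hεS ?_⟩
    obtain ⟨c, hc⟩ := hmesh n b hb
    have hcl : closure b ⊆ Metric.closedBall c (1 / (n + 1)) :=
      (closure_mono hc).trans Metric.closure_ball_subset_closedBall
    have h1 := Metric.mem_closedBall.1 (hcl h)
    have h2 := Metric.mem_closedBall.1 (hcl h')
    have h3 := dist_triangle_right y.1 x.1 c
    rw [Metric.mem_ball, Subtype.dist_eq]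
    linarith

theorem IsDiscreteFamily.isClosed_biUnion_closure {X : Type*} [TopologicalSpace X]
    {B : Set (Set X)} (hB : IsDiscreteFamily B) : IsClosed (⋃ b ∈ B, closure b) := by
  have : LocallyFinite (fun b : B => (b : Set X)) := fun x => by
    obtain ⟨U, hU, hsub⟩ := hB x
    refine ⟨U, hU, Set.Subsingleton.finite fun b hb b' hb' => Subtype.ext ?_⟩
    exact hsub ⟨b.2, hb⟩ ⟨b'.2, hb'⟩
  rw [biUnion_eq_iUnion]
  exact this.closure.isClosed_iUnion fun _ => isClosed_closure

/-- If TWO has a winning strategy in the game for `Y`, then `Y` is covered by countably many closed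
strongly zero-dimensional sets. ONE need only play covers by balls of radius `1 / (n + 1)`; for each
position in which ONE has moved in this way, take the points that TWO would, up to closure, cover
whichever such cover comes next. ONE could keep a point outside all these sets uncovered forever. -/
theorem TwoHasWinningStrategy.exists_cover {X : Type*} [MetricSpace X] {Y : Set X}
    (h : TwoHasWinningStrategy (openCovers X) (openCoversOf Y)) :
    ∃ D : List ℕ → Set X, (∀ σ, IsClosed (D σ)) ∧ (∀ σ, IsStronglyZeroDimensional (D σ)) ∧
      Y ⊆ ⋃ σ, D σ := by
  obtain ⟨F, hF⟩ := h
  let 𝒜 : ℕ → Set (Set X) := fun n => range fun c => Metric.ball c (1 / (n + 1))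
  have h𝒜 : ∀ n, 𝒜 n ∈ openCovers X := fun n => ⟨by
    rintro _ ⟨c, rfl⟩; exact Metric.isOpen_ball, fun x _ =>
      ⟨_, ⟨x, rfl⟩, Metric.mem_ball_self (by positivity)⟩⟩
  let B : List ℕ → ℕ → Set (Set X) := fun σ n => F ((σ ++ [n]).map 𝒜)
  -- every position that ONE can reach is part of a full play
  have hreply : ∀ σ n, IsDiscreteFamily (B σ n) ∧ Refines (B σ n) (𝒜 n) := by
    intro σ n
    have h1 := (hF (fun k => 𝒜 ((σ ++ [n]).getD k 0)) (fun k => h𝒜 _)).1 σ.length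
    have h2 : replyTwo F (fun k => 𝒜 ((σ ++ [n]).getD k 0)) σ.length = B σ n := by
      have : (List.range (σ.length + 1)).map (fun k => 𝒜 ((σ ++ [n]).getD k 0)) =
          (σ ++ [n]).map 𝒜 := by
        refine List.ext_getElem (by simp) fun k h1 h2 => ?_
        rw [List.length_map] at h2
        rw [List.getElem_map, List.getElem_map, List.getElem_range, List.getD_eq_getElem _ _ h2]
      simp only [replyTwo, B, this]
    rw [h2] at h1
    simpa using h1
  refine ⟨fun σ => ⋂ n, ⋃ b ∈ B σ n, closure b, fun σ => isClosed_iInter fun n =>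
    (hreply σ n).1.isClosed_biUnion_closure, fun σ => isStronglyZeroDimensional_iInter _
      (fun n => (hreply σ n).1) fun n b hb => ?_, fun y hy => ?_⟩
  · obtain ⟨_, ⟨c, rfl⟩, hc⟩ := (hreply σ n).2 b hb
    exact ⟨c, hc⟩
  by_contra hcon
  have hcon' : ∀ σ, ∃ n, ∀ b ∈ B σ n, y ∉ b := by
    intro σ
    by_contra! h
    refine hcon (mem_iUnion.2 ⟨σ, mem_iInter.2 fun n => ?_⟩)
    obtain ⟨b, hb, hyb⟩ := h n
    exact mem_biUnion hb (subset_closure hyb)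
  choose next hnext using hcon'
  -- ONE's play against `y`
  let σ : ℕ → List ℕ := fun k => Nat.rec [] (fun _ τ => τ ++ [next τ]) k
  have hσ : ∀ k, (List.range k).map (fun i => 𝒜 (next (σ i))) = (σ k).map 𝒜 := by
    intro k
    induction k with
    | zero => rfl
    | succ k ih =>
      rw [List.range_succ, List.map_append, ih]
      simp [σ]
  obtain ⟨b, hb, hyb⟩ := (hF (fun i => 𝒜 (next (σ i))) fun _ => h𝒜 _).2.2 hy
  obtain ⟨k, hk⟩ := mem_iUnion.1 hb
  refine hnext (σ k) b ?_ hyb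
  rw [replyTwo, hσ] at hk
  exact hk

theorem IsKuleszaSpace.not_twoHasWinningStrategy {K : Type*} [MetricSpace K] {P₁ : Set K}
    {P₂ : ℕ → Set K} (hK : IsKuleszaSpace K P₁ P₂) :
    ¬ TwoHasWinningStrategy (openCovers K) (openCoversOf P₁) := by
  intro h
  obtain ⟨D, hDc, hD0, hD⟩ := h.exists_cover
  refine hK.not_coveringDim_le_zero ((coveringDimLE_zero_iff K).2 ?_)
  let C : List ℕ ⊕ ℕ → Set K := Sum.elim D P₂
  refine isStronglyZeroDimensional_of_isClosedEmbedding (fun i => ((↑) : C i → K))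
    (fun i => IsClosed.isClosedEmbedding_subtypeVal ?_) ?_ ?_
  · rcases i with σ | m
    exacts [hDc σ, hK.isClosed m]
  · rintro (σ | m)
    exacts [hD0 σ, hK.stronglyZeroDimensional m]
  · simp only [Subtype.range_coe, C, iUnion_sum, Sum.elim_inl, Sum.elim_inr]
    exact univ_subset_iff.1 (hK.eq_union ▸ union_subset_union_left _ hD)

namespace Kulesza

variable {Ω : Type}

/-! ### Attachments of end points -/

/-- The three positions of end points in a cell. -/
inductive Pos
  | left
  | mid
  | right

/-- The label of a child of a node: the half of the parent cell in which the child lies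
(`side = false` for the left half) and the two letters with which it is attached to the end points
bounding this half. -/
structure Label (Ω : Type) where
  side : Bool
  left : Ω
  right : Ω

/-- An end point: the node of the cell it belongs to, its position there, and a sequence of
letters. Nodes are lists of labels with the most recent label first, so that the ancestors of a
node are its suffixes. -/
@[ext]
structure EndPt (Ω : Type) where
  node : List (Label Ω)
  pos : Pos
  seq : ℕ → Ω

/-- Prepend a letter to a sequence. -/
def scons (ξ : Ω) (f : ℕ → Ω) : ℕ → Ω
  | 0 => ξ
  | n + 1 => f n

theorem scons_head_tail (f : ℕ → Ω) : scons (f 0) (fun n => f (n + 1)) = f := by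
  funext n
  cases n <;> rfl

/-- The position in the parent cell, and the letter, through which an end point of the child `d` is
attached to an end point of the parent. The middle end points of the child are attached to
nothing. -/
def up (d : Label Ω) : Pos → Option (Pos × Ω)
  | .left => some (if d.side then .mid else .left, d.left)
  | .mid => none
  | .right => some (if d.side then .right else .mid, d.right)

/-- The outer end of the half of a cell. -/
def outward (side : Bool) : Pos := if side then .right else .left

theorem up_outward {d : Label Ω} {j j' : Pos} {ξ : Ω} (h : up d j = some (j', ξ))
    (hj' : j' ≠ .mid) : j = outward d.side ∧ j' = outward d.side := by
  cases j <;> cases hs : d.side <;> simp_all [up, outward]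

theorem up_snd {d : Label Ω} {j j' : Pos} {ξ : Ω} (h : up d j = some (j', ξ)) :
    (j = .left ∧ ξ = d.left) ∨ (j = .right ∧ ξ = d.right) := by
  cases j <;> simp_all [up]

section Root

variable (w : Label Ω → ℕ) (N : ℕ)

open Classical in
/-- Follow the attachments of an end point upwards as long as the labels passed have weight at
least `N`. -/
noncomputable def root : List (Label Ω) → Pos → (ℕ → Ω) → EndPt Ω
  | [], j, f => ⟨[], j, f⟩
  | d :: t, j, f =>
    match up d j with
    | some (j', ξ) => if N ≤ w d then root t j' (scons ξ f) else ⟨d :: t, j, f⟩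
    | none => ⟨d :: t, j, f⟩

variable {w N}

theorem root_cons_of_up {d : Label Ω} {j j' : Pos} {ξ : Ω} (h : up d j = some (j', ξ))
    (hN : N ≤ w d) (t : List (Label Ω)) (f : ℕ → Ω) :
    root w N (d :: t) j f = root w N t j' (scons ξ f) := by
  rw [root, h]; simp [hN]

theorem root_cons_stuck {d : Label Ω} {j : Pos} (h : up d j = none ∨ w d < N)
    (t : List (Label Ω)) (f : ℕ → Ω) : root w N (d :: t) j f = ⟨d :: t, j, f⟩ := by
  rw [root]
  rcases h with h | h
  · simp [h]
  · cases up d j <;> simp [h]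

theorem up_cases (w : Label Ω → ℕ) (N : ℕ) (d : Label Ω) (j : Pos) :
    (up d j = none ∨ w d < N) ∨ ∃ j' ξ, up d j = some (j', ξ) ∧ N ≤ w d := by
  rcases h : up d j with _ | ⟨j', ξ⟩
  · simp
  · rcases lt_or_ge (w d) N with h' | h'
    · simp [h']
    · exact .inr ⟨j', ξ, rfl, h'⟩

theorem root_node_suffix (t : List (Label Ω)) (j : Pos) (f : ℕ → Ω) :
    (root w N t j f).node <:+ t := by
  induction t generalizing j f with
  | nil => simp [root]
  | cons d t ih =>
    rcases up_cases w N d j with h | ⟨j', ξ, h, hN⟩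
    · rw [root_cons_stuck h]
    · rw [root_cons_of_up h hN]
      exact (ih _ _).trans (List.suffix_cons d t)

theorem root_eq_self {t : List (Label Ω)} {j : Pos} {f : ℕ → Ω}
    (h : t.length ≤ (root w N t j f).node.length) (g : ℕ → Ω) : root w N t j g = ⟨t, j, g⟩ := by
  cases t with
  | nil => simp [root]
  | cons d t =>
    rcases up_cases w N d j with h' | ⟨j', ξ, h', hN⟩
    · rw [root_cons_stuck h']
    · rw [root_cons_of_up h' hN] at h
      have := (root_node_suffix (w := w) (N := N) t j' (scons ξ f)).length_le
      simp at h; omega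

/-- A chain of attachments that ends above level `n` passes through level `n`. -/
theorem exists_root_eq_root {n : ℕ} (t : List (Label Ω)) (j : Pos) (f : ℕ → Ω) (hn : n ≤ t.length)
    (h : (root w N t j f).node.length ≤ n) :
    ∃ s j' g, s <:+ t ∧ s.length = n ∧ root w N t j f = root w N s j' g := by
  induction t generalizing j f with
  | nil => exact ⟨[], j, f, List.suffix_rfl, by simp at hn; simp [hn], rfl⟩
  | cons d t ih =>
    rcases hn.eq_or_lt with rfl | hn'
    · exact ⟨_, j, f, List.suffix_rfl, rfl, rfl⟩
    rcases up_cases w N d j with h' | ⟨j', ξ, h', hN⟩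
    · rw [root_cons_stuck h'] at h
      exact absurd h (by simpa using hn')
    · rw [root_cons_of_up h' hN] at h ⊢
      obtain ⟨s, j'', g, hs, hl, he⟩ := ih j' (scons ξ f) (by simpa [Nat.lt_succ_iff] using hn') h
      exact ⟨s, j'', g, hs.trans (List.suffix_cons d t), hl, he⟩

/-- A chain of attachments that passes two levels stays on the outer side: an end point attached to
a middle end point goes no further. -/
theorem root_cons_outward {d : Label Ω} {t : List (Label Ω)} {j : Pos} {f : ℕ → Ω}
    (h : (root w N (d :: t) j f).node.length < t.length) :
    j = outward d.side ∧ N ≤ w d ∧ ∃ ξ, up d j = some (outward d.side, ξ) ∧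
      root w N (d :: t) j f = root w N t (outward d.side) (scons ξ f) := by
  rcases up_cases w N d j with h' | ⟨j', ξ, h', hN⟩
  · rw [root_cons_stuck h'] at h
    simp at h
  · rw [root_cons_of_up h' hN] at h ⊢
    have hj' : j' ≠ .mid := by
      rintro rfl
      cases t with
      | nil => simp at h
      | cons d' t => rw [root_cons_stuck (.inl rfl)] at h; simp at h
    obtain ⟨h1, rfl⟩ := up_outward h' hj'
    exact ⟨h1, hN, ξ, h', rfl⟩

/-- A chain of attachments cannot leave a cell whose label has too small a weight. -/
theorem suffix_root {s : List (Label Ω)} (hs : ∀ d ∈ s.head?, w d < N) {t : List (Label Ω)}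
    (j : Pos) (f : ℕ → Ω) (hst : s <:+ t) : s <:+ (root w N t j f).node := by
  induction t generalizing j f with
  | nil => rw [List.suffix_nil] at hst; simp [hst]
  | cons d t ih =>
    rcases up_cases w N d j with h' | ⟨j', ξ, h', hN⟩
    · rwa [root_cons_stuck h']
    · rw [root_cons_of_up h' hN]
      rcases List.suffix_cons_iff.1 hst with rfl | hst
      · exact absurd hN (not_le.2 (hs d (by simp)))
      · exact ih _ _ hst

theorem root_root {M : ℕ} (hNM : N ≤ M) (t : List (Label Ω)) (j : Pos) (f : ℕ → Ω) :
    root w N (root w M t j f).node (root w M t j f).pos (root w M t j f).seq = root w N t j f := by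
  induction t generalizing j f with
  | nil => simp [root]
  | cons d t ih =>
    rcases up_cases w M d j with h' | ⟨j', ξ, h', hN⟩
    · rw [root_cons_stuck h']
    · rw [root_cons_of_up h' hN, root_cons_of_up h' (hNM.trans hN), ih]

/-- The letter of an end point that has a given absolute level is unchanged under attachment. -/
theorem root_seq (t : List (Label Ω)) (j : Pos) (f : ℕ → Ω) (k : ℕ) :
    (root w N t j f).seq (k + (t.length - (root w N t j f).node.length)) = f k := by
  induction t generalizing j f k with
  | nil => simp [root]
  | cons d t ih =>
    rcases up_cases w N d j with h | ⟨j', ξ, h, hN⟩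
    · rw [root_cons_stuck h]; simp
    · rw [root_cons_of_up h hN]
      have h1 := ih j' (scons ξ f) (k + 1)
      have h2 := (root_node_suffix (w := w) (N := N) t j' (scons ξ f)).length_le
      rw [show k + ((d :: t).length - (root w N t j' (scons ξ f)).node.length) =
        k + 1 + (t.length - (root w N t j' (scons ξ f)).node.length) by
          simp only [List.length_cons]; omega, h1]
      rfl

end Root

section Vert

variable [Inhabited Ω] (w : Label Ω → ℕ) (N : ℕ)

/-- Forget the letters of an end point beyond level `N`. -/
def trunc (e : EndPt Ω) : EndPt Ω :=
  ⟨e.node, e.pos, fun k => if k + e.node.length < N then e.seq k else default⟩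

/-- The class of an end point at level `N`: two end points are identified if they are joined by
attachments of weight at least `N`, up to letters beyond level `N`. -/
noncomputable def vert (e : EndPt Ω) : EndPt Ω := trunc N (root w N e.node e.pos e.seq)

variable {w N}

theorem trunc_eq_trunc {e e' : EndPt Ω} : trunc N e = trunc N e' ↔
    e.node = e'.node ∧ e.pos = e'.pos ∧ ∀ k, k + e.node.length < N → e.seq k = e'.seq k := by
  constructor
  · intro h
    simp only [trunc, EndPt.mk.injEq] at h
    refine ⟨h.1, h.2.1, fun k hk => ?_⟩
    have := congrFun h.2.2 k
    simp only [h.1] at this hk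
    simpa [hk] using this
  · rintro ⟨h1, h2, h3⟩
    simp only [trunc, EndPt.mk.injEq, h1, h2, true_and]
    funext k
    by_cases hk : k + e'.node.length < N
    · simp [hk, h3 k (by rwa [h1])]
    · simp [hk]

theorem trunc_root_congr {M : ℕ} (t : List (Label Ω)) (j : Pos) (f g : ℕ → Ω)
    (h : ∀ k, k + t.length < N → f k = g k) :
    trunc N (root w M t j f) = trunc N (root w M t j g) := by
  induction t generalizing j f g with
  | nil => exact trunc_eq_trunc.2 ⟨rfl, rfl, fun k hk => h k (by simpa [root] using hk)⟩
  | cons d t ih =>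
    rcases up_cases w M d j with h' | ⟨j', ξ, h', hN⟩
    · rw [root_cons_stuck h', root_cons_stuck h']
      exact trunc_eq_trunc.2 ⟨rfl, rfl, fun k hk => h k hk⟩
    · rw [root_cons_of_up h' hN, root_cons_of_up h' hN]
      refine ih _ _ _ fun k hk => ?_
      cases k with
      | zero => rfl
      | succ k => exact h k (by simp only [List.length_cons]; omega)

theorem vert_congr {e e' : EndPt Ω} (h1 : e.node = e'.node) (h2 : e.pos = e'.pos)
    (h3 : ∀ k, k + e.node.length < N → e.seq k = e'.seq k) : vert w N e = vert w N e' := by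
  obtain ⟨t, j, f⟩ := e
  obtain ⟨t', j', f'⟩ := e'
  obtain rfl : t = t' := h1
  obtain rfl : j = j' := h2
  exact trunc_root_congr t j f f' h3

theorem vert_eq_of_root_eq {e e' : EndPt Ω}
    (h : root w N e.node e.pos e.seq = root w N e'.node e'.pos e'.seq) :
    vert w N e = vert w N e' := congrArg (trunc N) h

theorem vert_eq_of_le {M : ℕ} (hNM : N ≤ M) {e e' : EndPt Ω} (h : vert w M e = vert w M e') :
    vert w N e = vert w N e' := by
  unfold vert
  rw [← root_root hNM, ← root_root hNM e'.node]
  obtain ⟨h1, h2, h3⟩ := trunc_eq_trunc.1 h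
  rw [← h1, ← h2]
  exact trunc_root_congr _ _ _ _ fun k hk => h3 k (by omega)

theorem vert_node (e : EndPt Ω) : (vert w N e).node = (root w N e.node e.pos e.seq).node := rfl

theorem vert_node_suffix (e : EndPt Ω) : (vert w N e).node <:+ e.node := root_node_suffix _ _ _

end Vert

/-! ### The points of the space and their approximations -/

/-- The points of the space: branches of the tree of nodes, and end points. -/
abbrev Pt (Ω : Type) : Type := (ℕ → Label Ω) ⊕ EndPt Ω

/-- The node of length `n` on a branch. -/
def pre (x : ℕ → Label Ω) : ℕ → List (Label Ω)
  | 0 => []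
  | n + 1 => x n :: pre x n

@[simp] theorem length_pre (x : ℕ → Label Ω) (n : ℕ) : (pre x n).length = n := by
  induction n with
  | zero => rfl
  | succ n ih => simp [pre, ih]

theorem pre_suffix_pre (x : ℕ → Label Ω) {m n : ℕ} (h : m ≤ n) : pre x m <:+ pre x n := by
  induction n, h using Nat.le_induction with
  | base => exact List.suffix_rfl
  | succ n _ ih => exact ih.trans (List.suffix_cons _ _)

/-- The point `z` lies in the cell of the node `t`. -/
def In (t : List (Label Ω)) : Pt Ω → Prop
  | .inl x => pre x t.length = t
  | .inr e => t <:+ e.node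

theorem suffix_eq_of_length_eq {α : Type*} {s t u : List α} (hs : s <:+ u) (ht : t <:+ u)
    (h : s.length = t.length) : s = t :=
  (List.suffix_of_suffix_length_le hs ht h.le).eq_of_length h

theorem In.of_suffix {s t : List (Label Ω)} (h : s <:+ t) {z : Pt Ω} (hz : In t z) : In s z := by
  rcases z with x | e
  · have := pre_suffix_pre x h.length_le
    rw [show pre x t.length = t from hz] at this
    exact suffix_eq_of_length_eq this h (by simp)
  · exact h.trans hz

theorem In.suffix {s t : List (Label Ω)} {z : Pt Ω} (hs : In s z) (ht : In t z)
    (h : s.length ≤ t.length) : s <:+ t := by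
  rcases z with x | e
  · rw [← show pre x s.length = s from hs, ← show pre x t.length = t from ht]
    exact pre_suffix_pre x h
  · exact List.suffix_of_suffix_length_le hs ht h

theorem In.eq {s t : List (Label Ω)} {z : Pt Ω} (hs : In s z) (ht : In t z)
    (h : s.length = t.length) : s = t := (hs.suffix ht h.le).eq_of_length h

/-- The end point `e` represents the point `z` at level `N`: it is the point `z` itself if this is
an end point of a cell of level less than `N`, and any end point of the cell of level `N` that
contains `z` otherwise. -/
def Rep (N : ℕ) (z : Pt Ω) (e : EndPt Ω) : Prop :=
  (z = .inr e ∧ e.node.length < N) ∨ (e.node.length = N ∧ In e.node z)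

section Rep

variable {N : ℕ} {z : Pt Ω} {e e' : EndPt Ω}

theorem Rep.length_le (h : Rep N z e) : e.node.length ≤ N := by
  rcases h with h | h <;> omega

theorem Rep.mem (h : Rep N z e) : In e.node z := by
  rcases h with ⟨rfl, _⟩ | h
  · exact List.suffix_rfl
  · exact h.2

theorem Rep.eq_inr (h : Rep N z e) (he : e.node.length < N) : z = .inr e := by
  rcases h with h | h
  · exact h.1
  · omega

theorem Rep.eq_of_lt (h : Rep N (.inr e) e') (he : e.node.length < N) : e' = e := by
  rcases h with h | h
  · exact (Sum.inr_injective h.1).symm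
  · have : e'.node.length ≤ e.node.length := List.IsSuffix.length_le h.2
    omega

theorem Rep.node_eq (h : Rep N z e) (h' : Rep N z e') : e.node = e'.node := by
  rcases h.length_le.lt_or_eq with he | he
  · obtain rfl := h.eq_inr he
    rw [h'.eq_of_lt he]
  rcases h'.length_le.lt_or_eq with he' | he'
  · obtain rfl := h'.eq_inr he'
    rw [h.eq_of_lt he']
  exact h.mem.eq h'.mem (he.trans he'.symm)

theorem exists_in_or (N : ℕ) (z : Pt Ω) :
    (∃ e : EndPt Ω, z = .inr e ∧ e.node.length < N) ∨ ∃ s, s.length = N ∧ In s z := by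
  rcases z with x | e
  · exact .inr ⟨pre x N, by simp, by simp [In]⟩
  · rcases lt_or_ge e.node.length N with h | h
    · exact .inl ⟨e, rfl, h⟩
    · exact .inr ⟨e.node.drop (e.node.length - N), by simp; omega, List.drop_suffix _ _⟩

theorem exists_rep [Inhabited Ω] (N : ℕ) (z : Pt Ω) : ∃ e, Rep N z e := by
  rcases exists_in_or N z with ⟨e, he⟩ | ⟨s, hs⟩
  · exact ⟨e, .inl he⟩
  · exact ⟨⟨s, .mid, fun _ => default⟩, .inr hs⟩

end Rep

section Near

variable [Inhabited Ω] (w : Label Ω → ℕ)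

/-- The star at level `N` of an end point `e`: the points with a representative identified with
`e`. -/
def Star (N : ℕ) (e : EndPt Ω) : Set (Pt Ω) := {z | ∃ e', Rep N z e' ∧ vert w N e' = vert w N e}

/-- Two points are near at level `N` if they have representatives with the same class. -/
def Near (N : ℕ) (z z' : Pt Ω) : Prop :=
  ∃ e e', Rep N z e ∧ Rep N z' e' ∧ vert w N e = vert w N e'

variable {w}

theorem Near.refl (N : ℕ) (z : Pt Ω) : Near w N z z := by
  obtain ⟨e, he⟩ := exists_rep N z
  exact ⟨e, e, he, he, rfl⟩

theorem Near.symm {N : ℕ} {z z' : Pt Ω} (h : Near w N z z') : Near w N z' z := by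
  obtain ⟨e, e', h1, h2, h3⟩ := h
  exact ⟨e', e, h2, h1, h3.symm⟩

theorem near_of_mem_star {N : ℕ} {e : EndPt Ω} {z z' : Pt Ω} (hz : z ∈ Star w N e)
    (hz' : z' ∈ Star w N e) : Near w N z z' := by
  obtain ⟨e1, h1, h1'⟩ := hz
  obtain ⟨e2, h2, h2'⟩ := hz'
  exact ⟨e1, e2, h1, h2, h1'.trans h2'.symm⟩

theorem star_congr {N : ℕ} {e e' : EndPt Ω} (h : vert w N e = vert w N e') :
    Star w N e = Star w N e' := by simp [Star, h]

theorem star_anti {N M : ℕ} (hNM : N ≤ M) {e : EndPt Ω} (he : e.node.length ≤ N) :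
    Star w M e ⊆ Star w N e := by
  rintro z ⟨e', hz, h⟩
  rcases lt_or_ge e'.node.length N with h' | h'
  · obtain rfl := hz.eq_inr (h'.trans_le hNM)
    exact ⟨e', .inl ⟨rfl, h'⟩, vert_eq_of_le hNM h⟩
  have hle : (root w M e'.node e'.pos e'.seq).node.length ≤ N := by
    have h1 := congrArg (fun a => a.node.length) h
    have h2 := (vert_node_suffix (w := w) (N := M) e).length_le
    simp only [vert_node] at h1 h2
    omega
  obtain ⟨s, j, g, hs, hl, hr⟩ := exists_root_eq_root _ _ _ h' hle
  refine ⟨⟨s, j, g⟩, .inr ⟨hl, hz.mem.of_suffix hs⟩, vert_eq_of_le hNM ?_⟩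
  rw [← h]
  exact (vert_eq_of_root_eq hr).symm

theorem in_of_mem_star {N : ℕ} {e : EndPt Ω} {z : Pt Ω} (hz : z ∈ Star w N e) :
    In (vert w N e).node z := by
  obtain ⟨e', h1, h2⟩ := hz
  rw [← h2]
  exact h1.mem.of_suffix (vert_node_suffix e')

/-- The stars of level `N + 1` are a star refinement of those of level `N`. A point of level
greater than `N` lies on an edge between two classes, one of which is the class of a middle end
point and stays inside the cell of level `N`; the class on the outer side takes in both. -/
theorem exists_star_subset (N : ℕ) (z : Pt Ω) : ∃ e : EndPt Ω, e.node.length ≤ N ∧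
    ∀ e', Rep (N + 1) z e' → Star w (N + 1) e' ⊆ Star w N e := by
  obtain ⟨e₀, h₀⟩ := exists_rep (N + 1) z
  rcases Nat.lt_or_ge N e₀.node.length with h | h
  · have hl : e₀.node.length = N + 1 := le_antisymm h₀.length_le h
    obtain ⟨d, t, ht⟩ := List.exists_cons_of_length_eq_add_one hl
    have htN : t.length = N := by simpa [ht] using hl
    refine ⟨⟨t, outward d.side, fun _ => default⟩, htN.le, fun e' he' => ?_⟩
    have hn : e'.node = d :: t := (he'.node_eq h₀).trans ht
    obtain ⟨t', j, f⟩ := e'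
    obtain rfl : t' = d :: t := hn
    rcases lt_or_ge (root w (N + 1) (d :: t) j f).node.length t.length with hlt | hge
    · obtain ⟨-, -, ξ, -, hr⟩ := root_cons_outward hlt
      rw [star_congr (e' := ⟨t, outward d.side, scons ξ f⟩) (vert_eq_of_root_eq hr)]
      refine (star_anti N.le_succ htN.le).trans (star_congr ?_).subset
      exact vert_congr rfl rfl fun k hk => absurd hk (by simp [htN])
    · intro y hy
      refine ⟨_, .inr ⟨htN, (in_of_mem_star hy).of_suffix ?_⟩, rfl⟩
      exact List.suffix_of_suffix_length_le (List.suffix_cons d t) (root_node_suffix _ _ _) hge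
  · refine ⟨e₀, h, fun e' he' => ?_⟩
    obtain rfl := h₀.eq_inr (Nat.lt_succ_of_le h)
    rw [he'.eq_of_lt (Nat.lt_succ_of_le h)]
    exact star_anti N.le_succ h

theorem Near.comp {N : ℕ} {z y z' : Pt Ω} (h : Near w (N + 1) z y) (h' : Near w (N + 1) y z') :
    Near w N z z' := by
  obtain ⟨e, -, H⟩ := exists_star_subset (w := w) N y
  obtain ⟨e1, e2, h1, h2, h3⟩ := h
  obtain ⟨e3, e4, h4, h5, h6⟩ := h'
  exact near_of_mem_star (H e2 h2 ⟨e1, h1, h3⟩) (H e3 h4 ⟨e4, h5, h6.symm⟩)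

theorem Near.anti {N M : ℕ} (hNM : N ≤ M) {z z' : Pt Ω} (h : Near w M z z') : Near w N z z' := by
  induction M, hNM using Nat.le_induction with
  | base => exact h
  | succ M _ ih => exact ih (h.comp (Near.refl _ _))

theorem near_of_in {t : List (Label Ω)} {z z' : Pt Ω} (hz : In t z) (hz' : In t z') :
    Near w t.length z z' :=
  ⟨⟨t, .mid, fun _ => default⟩, _, .inr ⟨rfl, hz⟩, .inr ⟨rfl, hz'⟩, rfl⟩

/-- Cells are saturated for the nearness relations of high level. -/
theorem exists_near_in (t : List (Label Ω)) :
    ∃ N₀, ∀ N ≥ N₀, ∀ z z' : Pt Ω, Near w N z z' → (In t z → In t z') := by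
  obtain ⟨m, hm⟩ : ∃ m, ∀ d ∈ t.head?, w d < m := by
    cases t with
    | nil => exact ⟨0, by simp⟩
    | cons d t => exact ⟨w d + 1, by simp⟩
  refine ⟨max m (t.length + 1), fun N hN z z' h hz => ?_⟩
  obtain ⟨e, e', h1, h2, h3⟩ := h
  have hte : t <:+ e.node := by
    rcases h1 with ⟨rfl, -⟩ | h1
    · exact hz
    · exact hz.suffix h1.2 (by have := le_of_max_le_right hN; omega)
  have := suffix_root (w := w) (N := N) (fun d hd => (hm d hd).trans_le (le_of_max_le_left hN))
    e.pos e.seq hte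
  rw [← vert_node, h3] at this
  exact h2.mem.of_suffix (this.trans (vert_node_suffix _))

theorem Near.eq {z z' : Pt Ω} (h : ∀ N, Near w N z z') : z = z' := by
  have hin : ∀ t, In t z ↔ In t z' := fun t => by
    obtain ⟨N, hN⟩ := exists_near_in (w := w) t
    exact ⟨hN N le_rfl z z' (h N), hN N le_rfl z' z (h N).symm⟩
  -- a branch is not an end point, because it leaves the cell of the latter
  have aux : ∀ (x : ℕ → Label Ω) (e : EndPt Ω),
      ¬ ∀ t, In t (.inl x : Pt Ω) ↔ In t (.inr e) := fun x e H => by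
    have h1 : In (pre x (e.node.length + 1)) (.inr e : Pt Ω) := (H _).1 (by simp [In])
    have := List.IsSuffix.length_le h1
    simp at this
  rcases z with x | e <;> rcases z' with x' | e'
  · congr 1
    funext n
    have h1 : In (pre x (n + 1)) (.inl x' : Pt Ω) := (hin _).1 (by simp [In])
    simp only [In, length_pre, pre, List.length_cons, List.cons.injEq] at h1
    exact h1.1.symm
  · exact absurd hin (aux x e')
  · exact absurd (fun t => (hin t).symm) (aux x' e)
  · have h1 : e.node <:+ e'.node := (hin e.node).1 List.suffix_rfl
    have h2 : e'.node <:+ e.node := (hin e'.node).2 List.suffix_rfl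
    have hn : e.node = e'.node := h1.eq_of_length (le_antisymm h1.length_le h2.length_le)
    obtain ⟨m, hm⟩ : ∃ m, ∀ d ∈ e.node.head?, w d < m := by
      rcases e.node with _ | ⟨d, t⟩
      · exact ⟨0, by simp⟩
      · exact ⟨w d + 1, by simp⟩
    -- for large `N` the end points are their own roots
    have hroot : ∀ N ≥ m, ∀ a : EndPt Ω, a.node = e.node → root w N a.node a.pos a.seq = a := by
      intro N hN a ha
      refine root_eq_self (f := a.seq) ?_ a.seq
      exact (suffix_root (fun d hd => (hm d (ha ▸ hd)).trans_le hN) _ _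
        List.suffix_rfl).length_le
    have key : ∀ N ≥ m, N > e.node.length → trunc N e = trunc N e' := by
      intro N hN hN'
      obtain ⟨a, a', ha, ha', hv⟩ := h N
      rw [ha.eq_of_lt hN', ha'.eq_of_lt (by rwa [← hn]), vert, vert, hroot N hN e rfl,
        hroot N hN e' hn.symm] at hv
      exact hv
    congr 1
    refine EndPt.ext hn ?_ ?_
    · exact (trunc_eq_trunc.1 (key (max m (e.node.length + 1)) (le_max_left _ _)
        (Nat.lt_of_succ_le (le_max_right _ _)))).2.1
    · funext k
      exact (trunc_eq_trunc.1 (key (max m (k + e.node.length + 1)) (le_max_left _ _)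
        ((Nat.lt_succ_of_le (Nat.le_add_left _ _)).trans_le (le_max_right _ _)))).2.2 k
        ((Nat.lt_succ_self _).trans_le (le_max_right _ _))

end Near

section Metric

/-! ### The metric -/

open Filter Uniformity

section Star

variable [Inhabited Ω] {w : Label Ω → ℕ}

/-- Two stars of small depth that meet coincide. -/
theorem vert_eq_of_mem_star {N : ℕ} {e e' : EndPt Ω} {z : Pt Ω} (hz : z ∈ Star w N e)
    (hz' : z ∈ Star w N e') (he : (vert w N e).node.length + 1 < N)
    (he' : (vert w N e').node.length + 1 < N) : vert w N e = vert w N e' := by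
  obtain ⟨a, ha, hae⟩ := hz
  obtain ⟨a', ha', hae'⟩ := hz'
  rw [← hae, ← hae']
  rcases ha.length_le.lt_or_eq with hl | hl
  · obtain rfl := ha.eq_inr hl
    rw [ha'.eq_of_lt hl]
  obtain ⟨t, j, f⟩ := a
  obtain ⟨t', j', f'⟩ := a'
  obtain rfl : t = t' := ha.node_eq ha'
  rcases t with _ | ⟨d, t⟩
  · simp at hl; omega
  rw [← hae, vert_node] at he
  rw [← hae', vert_node] at he'
  have hl' : t.length + 1 = N := hl
  obtain ⟨h1, -⟩ := root_cons_outward (f := f) (j := j) (t := t) (d := d) (w := w) (N := N)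
    (by dsimp only at he; omega)
  obtain ⟨h2, -⟩ := root_cons_outward (f := f') (j := j') (t := t) (d := d) (w := w) (N := N)
    (by dsimp only at he'; omega)
  exact vert_congr rfl (h1.trans h2.symm) fun k hk => absurd hk (by simp; omega)

end Star

/-- The space attached to a weight function on the labels. It is a type of its own because the
weight function determines the uniform structure. -/
def Space (_w : Label Ω → ℕ) : Type := Pt Ω

/-- A branch of the tree of nodes as a point of the space. -/
def branch (w : Label Ω → ℕ) (x : ℕ → Label Ω) : Space w := (Sum.inl x : Pt Ω)

/-- An end point as a point of the space. -/
def endPt (w : Label Ω → ℕ) (e : EndPt Ω) : Space w := (Sum.inr e : Pt Ω)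

variable {w : Label Ω → ℕ}

/-- The cell of a node. -/
def cell (w : Label Ω → ℕ) (t : List (Label Ω)) : Set (Space w) := {z | In t z}

theorem mem_cell_pre (x : ℕ → Label Ω) (n : ℕ) : branch w x ∈ cell w (pre x n) :=
  show pre x (pre x n).length = pre x n by rw [length_pre]

variable [Inhabited Ω]

/-- The pairs of points that are near at level `N`; these sets are a basis of the uniformity. -/
def nearSet (w : Label Ω → ℕ) (N : ℕ) : Set (Space w × Space w) := {p | Near w N p.1 p.2}

theorem hasBasis_nearSet (w : Label Ω → ℕ) :
    (⨅ N, 𝓟 (nearSet w N)).HasBasis (fun _ : ℕ => True) (nearSet w) :=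
  hasBasis_iInf_principal
    (directed_of_isDirected_le fun _ _ h _ hp => Near.anti h hp)

instance : UniformSpace (Space w) := UniformSpace.ofCore
  { uniformity := ⨅ N, 𝓟 (nearSet w N)
    refl := by
      refine le_iInf fun N => ?_
      rw [principal_le_iff]
      rintro V hV ⟨x, y⟩ (h : (x, y) ∈ SetRel.id)
      obtain rfl : x = y := h
      exact hV (Near.refl N x)
    symm := ((hasBasis_nearSet w).tendsto_iff (hasBasis_nearSet w)).2
      fun N _ => ⟨N, trivial, fun _ h => Near.symm h⟩
    comp := (((hasBasis_nearSet w).lift' (monotone_id.relComp monotone_id)).le_basis_iff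
      (hasBasis_nearSet w)).2
      fun N _ => ⟨N + 1, trivial, fun _ ⟨_, h, h'⟩ => Near.comp h h'⟩ }

theorem uniformity_hasBasis : (𝓤 (Space w)).HasBasis (fun _ : ℕ => True) (nearSet w) :=
  hasBasis_nearSet w

instance : (𝓤 (Space w)).IsCountablyGenerated := uniformity_hasBasis.isCountablyGenerated

theorem mem_nhds_iff_near {z : Space w} {S : Set (Space w)} :
    S ∈ 𝓝 z ↔ ∃ N, ∀ z', Near w N z z' → z' ∈ S := by
  rw [(nhds_basis_uniformity' uniformity_hasBasis).mem_iff]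
  simp only [true_and]
  exact Iff.rfl

instance : T0Space (Space w) := by
  rw [t0Space_iff_uniformity]
  exact fun x y h => Near.eq fun N => h _ (uniformity_hasBasis.mem_of_mem (i := N) trivial)

noncomputable instance : MetricSpace (Space w) := UniformSpace.metricSpace (Space w)

theorem isOpen_of_near {G : Set (Space w)} (h : ∀ z ∈ G, ∃ N, ∀ z', Near w N z z' → z' ∈ G) :
    IsOpen G :=
  isOpen_iff_mem_nhds.2 fun z hz => mem_nhds_iff_near.2 (h z hz)

theorem isClopen_of_near {G : Set (Space w)}
    (h : ∀ z, ∃ N, ∀ z', Near w N z z' → (z ∈ G ↔ z' ∈ G)) : IsClopen G := by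
  constructor
  · refine isOpen_compl_iff.1 (isOpen_of_near fun z hz => ?_)
    obtain ⟨N, hN⟩ := h z
    exact ⟨N, fun z' hz' => fun h' => hz ((hN z' hz').2 h')⟩
  · refine isOpen_of_near fun z hz => ?_
    obtain ⟨N, hN⟩ := h z
    exact ⟨N, fun z' hz' => (hN z' hz').1 hz⟩

theorem isClopen_cell (t : List (Label Ω)) : IsClopen (cell w t) := by
  obtain ⟨N, hN⟩ := exists_near_in (w := w) t
  exact isClopen_of_near fun z => ⟨N, fun z' h =>
    ⟨hN N le_rfl z z' h, hN N le_rfl z' z h.symm⟩⟩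

theorem cell_pre_mem_nhds (x : ℕ → Label Ω) (n : ℕ) :
    cell w (pre x n) ∈ 𝓝 (branch w x) :=
  (isClopen_cell _).isOpen.mem_nhds (mem_cell_pre x n)

/-- The cells containing a branch form a neighbourhood basis of it. -/
theorem exists_cell_pre_subset {x : ℕ → Label Ω} {S : Set (Space w)}
    (hS : S ∈ 𝓝 (branch w x)) : ∃ n, cell w (pre x n) ⊆ S := by
  obtain ⟨N, hN⟩ := mem_nhds_iff_near.1 hS
  refine ⟨N, fun z hz => hN z ?_⟩
  have := near_of_in (w := w) (t := pre x N) (z := .inl x) (z' := z) (by simp [In]) hz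
  rwa [length_pre] at this

/-! ### Completeness -/

/-- Every Cauchy filter contains a star of each level; the centre can be taken to be a root. -/
theorem exists_star_mem_of_cauchy {F : Filter (Space w)} (hF : Cauchy F) (N : ℕ) :
    ∃ e : EndPt Ω, root w N e.node e.pos e.seq = e ∧ (Star w N e : Set (Space w)) ∈ F := by
  obtain ⟨hne, h⟩ := uniformity_hasBasis.cauchy_iff.1 hF
  obtain ⟨S, hS, hSN⟩ := h (N + 1) trivial
  obtain ⟨z, hz⟩ := hne.nonempty_of_mem hS
  obtain ⟨e, -, he⟩ := exists_star_subset (w := w) N z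
  have hroot := root_root (w := w) (le_refl N) e.node e.pos e.seq
  refine ⟨root w N e.node e.pos e.seq, hroot, mem_of_superset hS fun y hy => ?_⟩
  rw [star_congr (vert_eq_of_root_eq hroot)]
  obtain ⟨e1, e2, h1, h2, h3⟩ : Near w (N + 1) z y := hSN z hz y hy
  exact he e1 h1 ⟨e2, h2, h3.symm⟩

instance : CompleteSpace (Space w) := by
  refine ⟨fun {F} hF => ?_⟩
  have hne : F.NeBot := hF.1
  by_cases H : ∀ N, ∃ s : List (Label Ω), s.length = N ∧ cell w s ∈ F
  · -- the cells of all levels in the filter determine a branch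
    choose s hsl hsF using H
    have hs : ∀ N, ∃ d, s (N + 1) = d :: s N := fun N => by
      obtain ⟨d, t, ht⟩ := List.exists_cons_of_length_eq_add_one (hsl (N + 1))
      obtain ⟨z, hz, hz'⟩ := hne.nonempty_of_mem (inter_mem (hsF N) (hsF (N + 1)))
      refine ⟨d, ?_⟩
      rw [ht]
      congr 1
      have htl : t.length = N := by simpa [ht] using hsl (N + 1)
      refine In.eq (z := z) (In.of_suffix (List.suffix_cons d t) ?_) hz (htl.trans (hsl N).symm)
      rw [← ht]; exact hz'
    choose x hx using hs
    have hpre : ∀ N, pre x N = s N := fun N => by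
      induction N with
      | zero => exact (List.length_eq_zero_iff.1 (hsl 0)).symm
      | succ N ih => rw [pre, ih, hx]
    refine ⟨branch w x, fun S hS => ?_⟩
    obtain ⟨n, hn⟩ := exists_cell_pre_subset hS
    exact mem_of_superset (hsF n) (by rwa [← hpre])
  · push Not at H
    obtain ⟨N₀, hN₀⟩ := H
    choose e her heF using exists_star_mem_of_cauchy hF
    have hvert : ∀ N, vert w N (e N) = trunc N (e N) := fun N => congrArg (trunc N) (her N)
    have hlt : ∀ N, (e N).node.length < N₀ := by
      intro N
      by_contra! hge
      refine hN₀ ((e N).node.drop ((e N).node.length - N₀)) (by simp; omega)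
        (mem_of_superset (heF N) fun z hz => ?_)
      have h1 := in_of_mem_star hz
      rw [hvert] at h1
      exact In.of_suffix (List.drop_suffix _ _) h1
    have hstep : ∀ N ≥ N₀ + 1, vert w N (e N) = vert w N (e (N + 1)) := by
      intro N hN
      have h1 := star_anti (w := w) (N := N) (M := N + 1) N.le_succ (e := e (N + 1))
        ((hlt _).le.trans (by omega))
      obtain ⟨z, hz, hz'⟩ := hne.nonempty_of_mem (inter_mem (heF N) (heF (N + 1)))
      refine vert_eq_of_mem_star hz (h1 hz') ?_ ?_
      · have := (vert_node_suffix (w := w) (N := N) (e N)).length_le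
        have := hlt N
        omega
      · have := (vert_node_suffix (w := w) (N := N) (e (N + 1))).length_le
        have := hlt (N + 1)
        omega
    have hsuf : ∀ N ≥ N₀ + 1, (e N).node <:+ (e (N + 1)).node := fun N hN => by
      have h1 := congrArg EndPt.node (hstep N hN)
      rw [hvert] at h1
      exact (show (e N).node = _ from h1) ▸ vert_node_suffix _
    -- from some level on the node of the centre is constant
    obtain ⟨N₁, hN₁, hmax⟩ : ∃ N₁ ≥ N₀ + 1, ∀ N ≥ N₀ + 1,
        (e N).node.length ≤ (e N₁).node.length := by
      have hb : BddAbove ((fun N => (e N).node.length) '' Ici (N₀ + 1)) :=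
        ⟨N₀, by rintro _ ⟨N, -, rfl⟩; exact (hlt N).le⟩
      obtain ⟨N₁, h1, h2⟩ := Nat.sSup_mem ((nonempty_Ici (a := N₀ + 1)).image _) hb
      exact ⟨N₁, h1, fun N hN => (le_csSup hb (mem_image_of_mem _ hN)).trans_eq h2.symm⟩
    have hnode : ∀ N ≥ N₁, (e N).node = (e N₁).node := by
      intro N hN
      induction N, hN using Nat.le_induction with
      | base => rfl
      | succ N hN ih =>
        have h1 := hsuf N (hN₁.trans hN)
        rw [ih] at h1
        exact (h1.eq_of_length (le_antisymm h1.length_le (hmax _ (by omega)))).symm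
    have htrunc : ∀ N ≥ N₁, ∀ M ≥ N, trunc N (e N) = trunc N (e M) := by
      intro N hN M hM
      induction M, hM using Nat.le_induction with
      | base => rfl
      | succ M hM ih =>
        rw [ih]
        have h1 := hstep M (hN₁.trans (hN.trans hM))
        have h2 : root w M (e (M + 1)).node (e (M + 1)).pos (e (M + 1)).seq = e (M + 1) := by
          refine root_eq_self (f := (e (M + 1)).seq) ?_ _
          have h3 := congrArg EndPt.node h1
          rw [hvert] at h3
          change (e M).node = (root w M _ _ _).node at h3
          rw [← h3, hnode M (by omega), hnode (M + 1) (by omega)]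
        rw [hvert, vert, h2] at h1
        obtain ⟨h3, h4, h5⟩ := trunc_eq_trunc.1 h1
        exact trunc_eq_trunc.2 ⟨h3, h4, fun k hk => h5 k (by omega)⟩
    set t := (e N₁).node with ht
    let f : ℕ → Ω := fun k => (e (max N₁ (k + t.length + 1))).seq k
    have hf : ∀ N ≥ N₁, ∀ k, k + t.length < N → f k = (e N).seq k := by
      intro N hN k hk
      refine (trunc_eq_trunc.1 (htrunc (max N₁ (k + t.length + 1)) (le_max_left _ _) N
        (by omega))).2.2 k ?_
      rw [hnode _ (le_max_left _ _)]
      exact Nat.lt_of_succ_le (le_max_right _ _)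
    refine ⟨endPt w ⟨t, (e N₁).pos, f⟩, fun S hS => ?_⟩
    obtain ⟨N, hN⟩ := mem_nhds_iff_near.1 hS
    obtain ⟨M, hNM, hM, htM⟩ : ∃ M, N ≤ M ∧ N₁ ≤ M ∧ t.length < M :=
      ⟨max N (max N₁ (t.length + 1)), by omega, by omega, by omega⟩
    refine mem_of_superset (heF M) fun z hz => hN z (Near.anti hNM (near_of_mem_star ?_ hz))
    exact ⟨_, .inl ⟨rfl, htM⟩, vert_congr (hnode M hM).symm
      (trunc_eq_trunc.1 (htrunc N₁ le_rfl M hM)).2.1 fun k hk => hf M hM k hk⟩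

/-! ### Zero-dimensionality -/

/-- A star of an end point is clopen as soon as its level exceeds that of the end point by two. Its
boundary could only consist of end points at the other end of infinitely many of its edges; such a
point is a middle end point, and then both letters of the edges, and hence their weights, are
determined. -/
theorem isClopen_star {e : EndPt Ω} {M : ℕ} (hM : e.node.length + 2 ≤ M) :
    IsClopen (X := Space w) (Star w M e) := by
  have hve := (vert_node_suffix (w := w) (N := M) e).length_le
  refine isClopen_of_near (w := w) (G := Star w M e) fun z => ?_
  rcases exists_in_or M z with ⟨e₀, rfl, he₀⟩ | ⟨s, hs, hsz⟩
  swap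
  · obtain ⟨N, hN⟩ := exists_near_in (w := w) s
    refine ⟨N, fun z' hz' => ?_⟩
    have hsz' := hN N le_rfl z z' hz' hsz
    have aux : ∀ y y' : Pt Ω, In s y → In s y' → y ∈ Star w M e → y' ∈ Star w M e := by
      rintro y y' hy hy' ⟨a, ha, hae⟩
      refine ⟨a, .inr ?_, hae⟩
      rcases ha with ⟨rfl, ha⟩ | ⟨ha, ha'⟩
      · have := List.IsSuffix.length_le hy
        omega
      · obtain rfl := ha'.eq hy (ha.trans hs.symm)
        exact ⟨ha, hy'⟩
    exact ⟨aux z z' hsz hsz', aux z' z hsz' hsz⟩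
  set p := e.seq (M - 1 - e.node.length)
  set q := e₀.seq 0
  obtain ⟨N, hMN, hw⟩ : ∃ N, M ≤ N ∧ ∀ b, w ⟨b, p, q⟩ < N ∧ w ⟨b, q, p⟩ < N := by
    refine ⟨M + w ⟨true, p, q⟩ + w ⟨true, q, p⟩ + w ⟨false, p, q⟩ + w ⟨false, q, p⟩ + 1,
      by omega, fun b => ?_⟩
    cases b <;> omega
  refine ⟨N, fun z' hz' => ?_⟩
  obtain ⟨e₀', e₁, h₀, h₁, hv⟩ := hz'
  obtain rfl := h₀.eq_of_lt (he₀.trans_le hMN)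
  have hz'₀ : z' ∈ Star w M e₀' := star_anti hMN he₀.le ⟨e₁, h₁, hv.symm⟩
  constructor
  · rintro ⟨a, ha, hae⟩
    obtain rfl := ha.eq_of_lt he₀
    rwa [← star_congr hae]
  intro hz'e
  refine ⟨e₀', .inl ⟨rfl, he₀⟩, ?_⟩
  by_contra hne
  have hdeep : M ≤ (vert w M e₀').node.length + 1 := by
    by_contra! h
    exact hne (vert_eq_of_mem_star hz'₀ hz'e h (by omega))
  have hve₀ := (vert_node_suffix (w := w) (N := M) e₀').length_le
  have hroot₀ : root w M e₀'.node e₀'.pos e₀'.seq = e₀' :=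
    root_eq_self (f := e₀'.seq) (by rw [vert_node] at hdeep; omega) _
  obtain ⟨⟨t, j, f⟩, ha, hae⟩ := hz'e
  obtain ⟨⟨t', j', f'⟩, hb, hbe⟩ := hz'₀
  obtain rfl : t = t' := ha.node_eq hb
  rcases ha.length_le.lt_or_eq with hl | hl
  · obtain rfl := ha.eq_inr hl
    rw [hb.eq_of_lt hl] at hbe
    exact hne (hbe.symm.trans hae)
  rcases t with _ | ⟨d, s⟩
  · simp at hl; omega
  have hl' : s.length + 1 = M := hl
  have hjj' : j ≠ j' := by
    rintro rfl
    have h1 : vert w M ⟨d :: s, j, f'⟩ = vert w M ⟨d :: s, j, f⟩ :=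
      vert_congr rfl rfl fun k hk => absurd hk (by simp only [List.length_cons]; omega)
    exact hne (hbe.symm.trans (h1.trans hae))
  -- the letter by which the edge is attached to the star
  have hroota : (root w M (d :: s) j f).node.length ≤ e.node.length := by
    have := congrArg (fun a => a.node.length) hae
    simp only [vert_node] at this hve
    omega
  obtain ⟨-, -, ξ, hup, hr⟩ := root_cons_outward (w := w) (N := M) (d := d) (t := s) (j := j)
    (f := f) (by omega)
  have hξ : ξ = p := by
    obtain ⟨h1, -, h3⟩ := trunc_eq_trunc.1 hae
    dsimp only at h1 h3
    rw [hr] at h1 h3 hroota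
    have h4 := root_seq (w := w) (N := M) s (outward d.side) (scons ξ f) 0
    have h5 := root_seq (w := w) (N := M) e.node e.pos e.seq (M - 1 - e.node.length)
    have h6 := (root_node_suffix (w := w) (N := M) e.node e.pos e.seq).length_le
    rw [h3 _ (by omega)] at h4
    rw [show M - 1 - e.node.length + (e.node.length -
      (root w M e.node e.pos e.seq).node.length) = 0 + (s.length -
        (root w M s (outward d.side) (scons ξ f)).node.length) by rw [h1]; omega, h4] at h5
    exact h5
  -- the letter by which it is attached to the boundary point
  obtain ⟨ξ', j₁, hup', hξ'⟩ : ∃ ξ' j₁, up d j' = some (j₁, ξ') ∧ ξ' = q := by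
    have h1 := trunc_eq_trunc.1 hbe
    dsimp only at h1
    rw [hroot₀] at h1
    rw [vert, hroot₀] at hdeep hve₀
    rcases up_cases w M d j' with h' | ⟨j₁, ξ', h', hN⟩
    · rw [root_cons_stuck h'] at h1
      have := congrArg List.length h1.1
      simp at this; omega
    · refine ⟨ξ', j₁, h', ?_⟩
      rw [root_cons_of_up h' hN] at h1
      have h2 : root w M s j₁ (scons ξ' f') = ⟨s, j₁, scons ξ' f'⟩ := by
        refine root_eq_self (f := scons ξ' f') ?_ _
        rw [h1.1]
        have : (trunc M e₀').node.length = e₀'.node.length := rfl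
        omega
      rw [h2] at h1
      exact h1.2.2 0 (by simp only; omega)
  have hwd : w d < N := by
    obtain ⟨b, x, y⟩ := d
    have hb1 := (hw b).1
    have hb2 := (hw b).2
    rcases up_snd hup with ⟨h1, h2⟩ | ⟨h1, h2⟩ <;> rcases up_snd hup' with ⟨h3, h4⟩ | ⟨h3, h4⟩
    · exact absurd (h1.trans h3.symm) hjj'
    · dsimp only at h2 h4
      rw [← h2, ← h4, hξ, hξ']; exact hb1
    · dsimp only at h2 h4
      rw [← h2, ← h4, hξ, hξ']; exact hb2
    · exact absurd (h1.trans h3.symm) hjj'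
  have hin : d :: s <:+ e₁.node := by
    rcases h₁ with ⟨rfl, -⟩ | h₁
    · exact ha.mem
    · exact ha.mem.suffix h₁.2 (by rw [h₁.1]; exact hl.trans_le hMN)
  have h1 := suffix_root (w := w) (N := N) (s := d :: s) (by simpa using hwd) e₁.pos e₁.seq hin
  rw [← vert_node, ← hv] at h1
  have := (h1.trans (vert_node_suffix _)).length_le
  simp only [List.length_cons] at this
  omega

theorem isZeroDimensional : IsZeroDimensional (Space w) := by
  intro z
  refine ⟨fun S => ⟨fun hS => ?_, fun ⟨G, ⟨hz, hG⟩, hGS⟩ =>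
    Filter.mem_of_superset (hG.isOpen.mem_nhds hz) hGS⟩⟩
  rcases z with x | e
  · obtain ⟨n, hn⟩ := exists_cell_pre_subset hS
    exact ⟨cell w (pre x n), ⟨mem_cell_pre x n, isClopen_cell _⟩, hn⟩
  · obtain ⟨N, hN⟩ := mem_nhds_iff_near.1 hS
    have he : endPt w e ∈ Star w (max N (e.node.length + 2)) e :=
      ⟨e, .inl ⟨rfl, by omega⟩, rfl⟩
    exact ⟨Star w (max N (e.node.length + 2)) e, ⟨he, isClopen_star (le_max_right _ _)⟩,
      fun z' hz' => hN z' ((near_of_mem_star he hz').anti (le_max_left _ _))⟩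

end Metric

/-! ### The subspaces of branches and of end points -/

section Branches

variable {w : Label Ω → ℕ}

instance : TopologicalSpace (Label Ω) := ⊥

instance : DiscreteTopology (Label Ω) := ⟨rfl⟩

theorem pre_congr {x y : ℕ → Label Ω} {n : ℕ} (h : ∀ i < n, x i = y i) : pre x n = pre y n := by
  induction n with
  | zero => rfl
  | succ n ih => rw [pre, pre, h n n.lt_succ_self, ih fun i hi => h i (hi.trans n.lt_succ_self)]

theorem mem_cell_iff {x : ℕ → Label Ω} {t : List (Label Ω)} :
    branch w x ∈ cell w t ↔ pre x t.length = t := Iff.rfl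

/-- The end points of cells of level at most `m`. -/
def endPts (w : Label Ω → ℕ) (m : ℕ) : Set (Space w) := {z | ∃ e, z = endPt w e ∧ e.node.length ≤ m}

theorem range_branch_union : range (branch w) ∪ ⋃ m, endPts w m = univ := by
  refine eq_univ_of_forall fun z => ?_
  rcases z with x | e
  · exact .inl ⟨x, rfl⟩
  · exact .inr (mem_iUnion.2 ⟨_, e, rfl, le_rfl⟩)

variable [Inhabited Ω]

theorem isEmbedding_branch : IsEmbedding (branch w) := by
  refine ⟨isInducing_iff_nhds.2 fun x => le_antisymm ?_ ?_, fun x y h => Sum.inl_injective h⟩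
  · rw [← Filter.map_le_iff_le_comap]
    intro S hS
    obtain ⟨n, hn⟩ := exists_cell_pre_subset hS
    have h : (⋂ i ∈ Iio n, {y : ℕ → Label Ω | y i = x i}) ∈ 𝓝 x :=
      (Filter.biInter_mem (finite_Iio n)).2 fun i _ =>
        (continuous_apply i).continuousAt.preimage_mem_nhds ((isOpen_discrete {x i}).mem_nhds rfl)
    refine Filter.mem_map.2 (Filter.mem_of_superset h fun y hy => hn ?_)
    rw [mem_cell_iff, length_pre]
    exact pre_congr fun i hi => mem_iInter₂.1 hy i hi
  · change Filter.Tendsto id (Filter.comap (branch w) (𝓝 (branch w x))) (𝓝 x)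
    rw [tendsto_pi_nhds]
    intro i
    rw [nhds_discrete (Label Ω), Filter.tendsto_pure]
    refine Filter.mem_of_superset (Filter.preimage_mem_comap (cell_pre_mem_nhds x (i + 1))) ?_
    intro y hy
    rw [mem_preimage, mem_cell_iff, length_pre, pre, pre, List.cons.injEq] at hy
    exact hy.1

theorem isStronglyZeroDimensional_range_branch :
    IsStronglyZeroDimensional (range (branch w)) := by
  refine isStronglyZeroDimensional_of_setoid (fun n =>
    { r := fun x y => ∀ t : List (Label Ω), t.length = n → (x.1 ∈ cell w t ↔ y.1 ∈ cell w t)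
      iseqv := ⟨fun x t _ => Iff.rfl, fun h t ht => (h t ht).symm,
        fun h h' t ht => (h t ht).trans (h' t ht)⟩ }) ?_ ?_
  · rintro n ⟨_, x, rfl⟩
    refine Filter.mem_of_superset
      (continuous_subtype_val.continuousAt.preimage_mem_nhds (cell_pre_mem_nhds x n)) ?_
    rintro ⟨_, y, rfl⟩ hy t rfl
    rw [mem_preimage, mem_cell_iff, length_pre] at hy
    simp only [mem_cell_iff, hy]
  · rintro ⟨_, x, rfl⟩ U hU
    obtain ⟨S, hS, hSU⟩ := mem_nhds_subtype _ _ _ |>.1 hU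
    obtain ⟨n, hn⟩ := exists_cell_pre_subset hS
    exact ⟨n, fun y hy => hSU (hn ((hy (pre x n) (length_pre x n)).1 (mem_cell_pre x n)))⟩

theorem isClosed_endPts (m : ℕ) : IsClosed (endPts w m) := by
  have : (endPts w m)ᶜ = ⋃ t ∈ {t : List (Label Ω) | t.length = m + 1}, cell w t := by
    ext z
    simp only [mem_compl_iff, mem_iUnion, mem_ofPred_eq, exists_prop]
    constructor
    · intro hz
      rcases exists_in_or (m + 1) z with ⟨e, rfl, he⟩ | ⟨s, hs, hsz⟩
      · exact absurd ⟨e, rfl, Nat.lt_succ_iff.1 he⟩ hz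
      · exact ⟨s, hs, hsz⟩
    · rintro ⟨t, ht, hz⟩ ⟨e, rfl, he⟩
      have := List.IsSuffix.length_le (show t <:+ e.node from hz)
      omega
  rw [← isOpen_compl_iff, this]
  exact isOpen_biUnion fun t _ => (isClopen_cell t).isOpen

/-- On end points of bounded level, the nearness relations of high level are transitive, because
each such point has only one representative. -/
theorem isStronglyZeroDimensional_endPts (m : ℕ) : IsStronglyZeroDimensional (endPts w m) := by
  refine isStronglyZeroDimensional_of_setoid (fun n =>
    { r := fun x y => Near w (m + 1 + n) x.1 y.1
      iseqv := ⟨fun x => Near.refl _ _, Near.symm, ?_⟩ }) ?_ ?_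
  · rintro ⟨_, x, rfl, hx⟩ ⟨_, y, rfl, hy⟩ ⟨_, z, rfl, hz⟩ ⟨a, b, ha, hb, hab⟩ ⟨c, d, hc, hd, hcd⟩
    obtain rfl := Rep.eq_of_lt hb (by omega)
    obtain rfl := Rep.eq_of_lt hc (by omega)
    exact ⟨a, d, ha, hd, hab.trans hcd⟩
  · intro n x
    exact continuous_subtype_val.continuousAt.preimage_mem_nhds
      (mem_nhds_iff_near.2 ⟨m + 1 + n, fun z h => h⟩ : {z | Near w (m + 1 + n) x.1 z} ∈ 𝓝 x.1)
  · intro x U hU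
    obtain ⟨S, hS, hSU⟩ := mem_nhds_subtype _ _ _ |>.1 hU
    obtain ⟨n, hn⟩ := mem_nhds_iff_near.1 hS
    exact ⟨n, fun y hy => hSU (hn _ (Near.anti (Nat.le_add_left _ _) hy))⟩

theorem exists_pre_eq (t : List (Label Ω)) : ∃ x, pre x t.length = t := by
  induction t with
  | nil => exact ⟨fun _ => ⟨true, default, default⟩, rfl⟩
  | cons d t ih =>
    obtain ⟨x, hx⟩ := ih
    refine ⟨Function.update x t.length d, ?_⟩
    rw [List.length_cons, pre, Function.update_self]
    congr 1
    refine (pre_congr fun i hi => ?_).trans hx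
    rw [Function.update_of_ne hi.ne]

end Branches

section Weight

variable {e : Ω → Ω → ℕ}

/-- The weight of a label, given by a function of its two letters. -/
def weight (e : Ω → Ω → ℕ) (d : Label Ω) : ℕ := e d.left d.right

/-- An end point is attached, with arbitrarily large weight, to an end point of some child. -/
theorem exists_up_eq (h₁ : ∀ a N, ∃ b, N ≤ e a b) (h₂ : ∀ b N, ∃ a, N ≤ e a b) (N : ℕ) (j : Pos)
    (ξ : Ω) : ∃ d j', up d j' = some (j, ξ) ∧ N ≤ weight e d := by
  obtain ⟨b, hb⟩ := h₁ ξ N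
  obtain ⟨a, ha⟩ := h₂ ξ N
  cases j
  · exact ⟨⟨false, ξ, b⟩, .left, rfl, hb⟩
  · exact ⟨⟨true, ξ, b⟩, .left, rfl, hb⟩
  · exact ⟨⟨true, a, ξ⟩, .right, rfl, ha⟩

variable [Inhabited Ω]

theorem exists_near_branch (h₁ : ∀ a N, ∃ b, N ≤ e a b) (h₂ : ∀ b N, ∃ a, N ≤ e a b) (N : ℕ)
    (a : EndPt Ω) : ∃ x, Near (weight e) N (endPt (weight e) a) (branch (weight e) x) := by
  obtain ⟨M, hNM, haM⟩ : ∃ M, N ≤ M ∧ a.node.length < M :=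
    ⟨N + a.node.length + 1, by omega, by omega⟩
  have key : ∀ n t j f, t.length + n = M → ∃ s j' f', s.length = M ∧
      vert (weight e) M ⟨s, j', f'⟩ = vert (weight e) M ⟨t, j, f⟩ := by
    intro n
    induction n with
    | zero => exact fun t j f h => ⟨t, j, f, h, rfl⟩
    | succ n ih =>
      intro t j f h
      obtain ⟨d, j', hup, hd⟩ := exists_up_eq h₁ h₂ M j (f 0)
      obtain ⟨s, j'', f', hs, hv⟩ := ih (d :: t) j' (fun n => f (n + 1)) (by
        simp only [List.length_cons]; omega)
      refine ⟨s, j'', f', hs, hv.trans (vert_eq_of_root_eq ?_)⟩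
      rw [root_cons_of_up hup hd, scons_head_tail]
  obtain ⟨s, j, f, hs, hv⟩ := key (M - a.node.length) a.node a.pos a.seq (by omega)
  obtain ⟨x, hx⟩ := exists_pre_eq s
  exact ⟨x, Near.anti hNM ⟨a, ⟨s, j, f⟩, .inl ⟨rfl, haM⟩, .inr ⟨hs, hx⟩, hv.symm⟩⟩

theorem isNowhereDense_endPts (h₁ : ∀ a N, ∃ b, N ≤ e a b) (h₂ : ∀ b N, ∃ a, N ≤ e a b) (m : ℕ) :
    IsNowhereDense (endPts (weight e) m) := by
  rw [(isClosed_endPts m).isNowhereDense_iff, eq_empty_iff_forall_notMem]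
  intro z hz
  obtain ⟨a, rfl, -⟩ := interior_subset hz
  obtain ⟨N, hN⟩ := mem_nhds_iff_near.1 (mem_interior_iff_mem_nhds.1 hz)
  obtain ⟨x, hx⟩ := exists_near_branch h₁ h₂ N a
  obtain ⟨_, h, -⟩ := hN _ hx
  exact absurd h (by simp [branch, endPt])

end Weight

/-! ### Null sets of sequences -/

/-- A set of sequences is null if countable sets of letters can be assigned to all finite sequences
in such a way that every sequence in the set enters one of the sets assigned to its initial
segments. -/
def IsNull (P : Set (ℕ → Ω)) : Prop :=
  ∃ σ : List Ω → Set Ω, (∀ l, (σ l).Countable) ∧ ∀ f ∈ P, ∃ n, f n ∈ σ ((List.range n).map f)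

theorem IsNull.mono {P Q : Set (ℕ → Ω)} (hQ : IsNull Q) (h : P ⊆ Q) : IsNull P := by
  obtain ⟨σ, h1, h2⟩ := hQ
  exact ⟨σ, h1, fun f hf => h2 f (h hf)⟩

theorem IsNull.iUnion {ι : Type*} [Countable ι] {P : ι → Set (ℕ → Ω)} (h : ∀ i, IsNull (P i)) :
    IsNull (⋃ i, P i) := by
  choose σ h1 h2 using h
  refine ⟨fun l => ⋃ i, σ i l, fun l => countable_iUnion fun i => h1 i l, fun f hf => ?_⟩
  obtain ⟨i, hi⟩ := mem_iUnion.1 hf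
  obtain ⟨n, hn⟩ := h2 i f hi
  exact ⟨n, mem_iUnion.2 ⟨i, hn⟩⟩

theorem IsNull.union {P Q : Set (ℕ → Ω)} (hP : IsNull P) (hQ : IsNull Q) : IsNull (P ∪ Q) := by
  rw [union_eq_iUnion]
  exact IsNull.iUnion fun b => by cases b <;> assumption

theorem nonempty_of_not_isNull {P : Set (ℕ → Ω)} (hP : ¬ IsNull P) : P.Nonempty := by
  by_contra h
  rw [not_nonempty_iff_eq_empty] at h
  exact hP ⟨fun _ => ∅, fun _ => countable_empty, by simp [h]⟩

theorem not_isNull_univ [Uncountable Ω] : ¬ IsNull (univ : Set (ℕ → Ω)) := by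
  rintro ⟨σ, h1, h2⟩
  have hne : ∀ l, ∃ ξ, ξ ∉ σ l := fun l => by
    by_contra! h
    exact not_countable_univ ((h1 l).mono fun ξ _ => h ξ)
  choose next hnext using hne
  let s : ℕ → List Ω := fun n => Nat.rec [] (fun _ l => l ++ [next l]) n
  have hs : ∀ n, (List.range n).map (fun n => next (s n)) = s n := fun n => by
    induction n with
    | zero => rfl
    | succ n ih =>
      rw [List.range_succ, List.map_append, ih]
      rfl
  obtain ⟨n, hn⟩ := h2 (fun n => next (s n)) (mem_univ _)
  rw [hs] at hn
  exact hnext _ hn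

/-- A set of sequences that is not null has uncountably many sections that are not null. -/
theorem not_countable_section {P : Set (ℕ → Ω)} (hP : ¬ IsNull P) :
    ¬ {ξ | ¬ IsNull {g | scons ξ g ∈ P}}.Countable := by
  intro hc
  refine hP ?_
  have : ∀ ξ, ∃ σ : List Ω → Set Ω, (∀ l, (σ l).Countable) ∧ (IsNull {g | scons ξ g ∈ P} →
      ∀ g, scons ξ g ∈ P → ∃ n, g n ∈ σ ((List.range n).map g)) := by
    intro ξ
    by_cases h : IsNull {g | scons ξ g ∈ P}
    · obtain ⟨σ, h1, h2⟩ := h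
      exact ⟨σ, h1, fun _ => h2⟩
    · exact ⟨fun _ => ∅, fun _ => countable_empty, fun h' => absurd h' h⟩
  choose σ h1 h2 using this
  refine ⟨fun l => match l with
    | [] => {ξ | ¬ IsNull {g | scons ξ g ∈ P}}
    | ξ :: l => σ ξ l, fun l => ?_, fun f hf => ?_⟩
  · cases l with
    | nil => exact hc
    | cons ξ l => exact h1 ξ l
  · by_cases h : IsNull {g | scons (f 0) g ∈ P}
    · obtain ⟨n, hn⟩ := h2 (f 0) h (fun n => f (n + 1)) (by rwa [scons_head_tail])
      refine ⟨n + 1, ?_⟩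
      rw [List.range_succ_eq_map, List.map_cons, List.map_map]
      exact hn
    · exact ⟨0, h⟩

/-! ### The space is not strongly zero-dimensional -/

section Dim

variable [Inhabited Ω] {w : Label Ω → ℕ}

theorem near_of_up {d : Label Ω} {j j' : Pos} {ξ : Ω} (hup : up d j = some (j', ξ)) {N : ℕ}
    (hN : N ≤ w d) {t : List (Label Ω)} (ht : t.length + 1 < N) (g : ℕ → Ω) :
    Near w N (endPt w ⟨t, j', scons ξ g⟩) (endPt w ⟨d :: t, j, g⟩) :=
  ⟨_, _, .inl ⟨rfl, by dsimp only; omega⟩, .inl ⟨rfl, ht⟩,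
    (vert_eq_of_root_eq (root_cons_of_up hup hN t g)).symm⟩

theorem exists_not_isNull_near {G : Set (Space w)} (hG : IsOpen G) {t : List (Label Ω)} {j : Pos}
    (h : ¬ IsNull {f | endPt w ⟨t, j, f⟩ ∈ G}) :
    ∃ N, ¬ IsNull {f | ∀ z, Near w N (endPt w ⟨t, j, f⟩) z → z ∈ G} := by
  by_contra! hcon
  refine h ((IsNull.iUnion hcon).mono fun f hf => ?_)
  obtain ⟨N, hN⟩ := mem_nhds_iff_near.1 (hG.mem_nhds hf)
  exact mem_iUnion.2 ⟨N, hN⟩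

/-- The clopen set `U` separates the cell of `t`: it contains many left end points of the cell and
misses many of its right end points. -/
def Separates (U : Set (Space w)) (t : List (Label Ω)) : Prop :=
  ¬ IsNull {f | endPt w ⟨t, .left, f⟩ ∈ U} ∧ ¬ IsNull {f | endPt w ⟨t, .right, f⟩ ∈ Uᶜ}

/-- A clopen set that separates a cell separates one of its children. Many middle end points lie in
the set, or many do not; this determines a half of the cell that is separated. By the choice of the
weight there is a child in this half attached to many end points on both sides, with a weight so
large that `U` or its complement passes along the attachments. -/
theorem Separates.exists_cons {e : Ω → Ω → ℕ} [Uncountable Ω]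
    (he : ∀ A B : Set Ω, ¬ A.Countable → ¬ B.Countable → ∀ N, ∃ a ∈ A, ∃ b ∈ B, N ≤ e a b)
    {U : Set (Space (weight e))} (hU : IsClopen U) {t : List (Label Ω)} (ht : Separates U t) :
    ∃ d, Separates U (d :: t) := by
  obtain ⟨side, hl, hr⟩ : ∃ side : Bool,
      (¬ IsNull {f | endPt _ ⟨t, if side then .mid else .left, f⟩ ∈ U}) ∧
      ¬ IsNull {f | endPt _ ⟨t, if side then .right else .mid, f⟩ ∈ Uᶜ} := by
    by_cases h : IsNull {f | endPt (weight e) ⟨t, .mid, f⟩ ∈ U}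
    · refine ⟨false, ht.1, fun h' => not_isNull_univ ((h.union h').mono fun f _ => ?_)⟩
      exact em (endPt (weight e) ⟨t, .mid, f⟩ ∈ U)
    · exact ⟨true, h, ht.2⟩
  obtain ⟨N₁, h₁⟩ := exists_not_isNull_near hU.isOpen hl
  obtain ⟨N₂, h₂⟩ := exists_not_isNull_near hU.compl.isOpen hr
  obtain ⟨ξ, hξ, ξ', hξ', hN⟩ := he _ _ (not_countable_section h₁) (not_countable_section h₂)
    (max (max N₁ N₂) (t.length + 2))
  have hlen : t.length + 1 < max (max N₁ N₂) (t.length + 2) :=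
    Nat.lt_of_succ_le (le_max_right _ _)
  refine ⟨⟨side, ξ, ξ'⟩, fun h => hξ (h.mono fun g hg => hg _ ?_),
    fun h => hξ' (h.mono fun g hg => hg _ ?_)⟩
  · refine Near.anti ?_ (near_of_up (d := ⟨side, ξ, ξ'⟩) rfl hN hlen g)
    exact (le_max_left _ _).trans (le_max_left _ _)
  · refine Near.anti ?_ (near_of_up (d := ⟨side, ξ, ξ'⟩) rfl hN hlen g)
    exact (le_max_right _ _).trans (le_max_left _ _)

theorem not_separates_nil {e : Ω → Ω → ℕ} [Uncountable Ω]
    (he : ∀ A B : Set Ω, ¬ A.Countable → ¬ B.Countable → ∀ N, ∃ a ∈ A, ∃ b ∈ B, N ≤ e a b)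
    {U : Set (Space (weight e))} (hU : IsClopen U) : ¬ Separates U [] := by
  intro h
  choose d hd using fun t : {t // Separates U t} => t.2.exists_cons he hU
  let T : ℕ → {t // Separates U t} := fun n => Nat.rec ⟨[], h⟩ (fun _ t => ⟨d t :: t.1, hd t⟩) n
  have hT : ∀ n, pre (fun n => d (T n)) n = (T n).1 := fun n => by
    induction n with
    | zero => rfl
    | succ n ih => rw [pre, ih]
  have hsep : ∀ n, Separates U (pre (fun n => d (T n)) n) := fun n => hT n ▸ (T n).2
  set x := fun n => d (T n)
  have hcell : ∀ t j f, endPt (weight e) ⟨t, j, f⟩ ∈ cell (weight e) t := fun t j f =>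
    List.suffix_rfl
  by_cases hx : branch (weight e) x ∈ U
  · obtain ⟨n, hn⟩ := exists_cell_pre_subset (hU.isOpen.mem_nhds hx)
    obtain ⟨f, hf⟩ := nonempty_of_not_isNull (hsep n).2
    exact hf (hn (hcell _ _ _))
  · obtain ⟨n, hn⟩ := exists_cell_pre_subset (hU.compl.isOpen.mem_nhds hx)
    obtain ⟨f, hf⟩ := nonempty_of_not_isNull (hsep n).1
    exact hn (hcell _ _ _) hf

theorem isClosed_endPt_nil (w : Label Ω → ℕ) (j : Pos) :
    IsClosed (range fun f => endPt w ⟨[], j, f⟩) := by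
  rw [← isOpen_compl_iff]
  refine isOpen_of_near fun z hz => ?_
  rcases exists_in_or 1 z with ⟨⟨t, j', f⟩, rfl, he⟩ | ⟨s, hs, hsz⟩
  · obtain rfl : t = [] := List.length_eq_zero_iff.1 (Nat.lt_one_iff.1 he)
    refine ⟨1, ?_⟩
    rintro _ ⟨a, b, ha, hb, hab⟩ ⟨g, rfl⟩
    obtain rfl := ha.eq_of_lt Nat.one_pos
    obtain rfl := Rep.eq_of_lt hb Nat.one_pos
    refine hz ⟨f, ?_⟩
    have h1 : j' = j := (trunc_eq_trunc.1 hab).2.1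
    rw [h1]; rfl
  · obtain ⟨N, hN⟩ := exists_near_in (w := w) s
    refine ⟨N, fun z' hz' => ?_⟩
    rintro ⟨g, rfl⟩
    have := List.IsSuffix.length_le (show s <:+ [] from hN N le_rfl _ _ hz' hsz)
    simp [hs] at this

theorem not_isStronglyZeroDimensional {e : Ω → Ω → ℕ} [Uncountable Ω]
    (he : ∀ A B : Set Ω, ¬ A.Countable → ¬ B.Countable → ∀ N, ∃ a ∈ A, ∃ b ∈ B, N ≤ e a b) :
    ¬ IsStronglyZeroDimensional (Space (weight e)) := by
  intro h
  obtain ⟨U, hU, hL, hR⟩ := h.exists_isClopen (isClosed_endPt_nil _ .left)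
    (isClosed_endPt_nil _ .right) (disjoint_left.2 (by
      rintro _ ⟨f, rfl⟩ ⟨g, hg⟩
      have := Sum.inr_injective hg
      simp at this))
  refine not_separates_nil he hU ⟨fun h => not_isNull_univ (h.mono ?_),
    fun h => not_isNull_univ (h.mono ?_)⟩
  · exact fun f _ => hL ⟨f, rfl⟩
  · exact fun f _ hf => disjoint_left.1 hR hf ⟨f, rfl⟩

end Dim

/-! ### The weight function -/

/-- On a set of cardinality `ℵ₁` there is a function to the natural numbers that is unbounded on
every product of two uncountable sets and on every row and column. It is built from injections of
the proper initial segments of a well-order of type `ω₁` into the natural numbers; adding a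
surjection onto the natural numbers in each variable makes the rows and columns unbounded. -/
theorem exists_unbounded_weight (hΩ : Cardinal.mk Ω = Cardinal.aleph 1) : ∃ e : Ω → Ω → ℕ,
    (∀ A B : Set Ω, ¬ A.Countable → ¬ B.Countable → ∀ N, ∃ a ∈ A, ∃ b ∈ B, N ≤ e a b) ∧
    (∀ a N, ∃ b, N ≤ e a b) ∧ ∀ b N, ∃ a, N ≤ e a b := by
  obtain ⟨r, hwo, hr⟩ := Cardinal.exists_ord_eq Ω
  have hseg : ∀ a, {b | r b a}.Countable := fun a => by
    rw [← Cardinal.le_aleph0_iff_set_countable, ← Order.lt_succ_iff, Cardinal.succ_aleph0, ← hΩ]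
    have h := Ordinal.typein_lt_type r a
    rw [← hr, Cardinal.lt_ord, Ordinal.card_typein] at h
    exact h
  have : Uncountable Ω := Cardinal.aleph0_lt_mk_iff.1 (hΩ ▸ Cardinal.aleph0_lt_aleph_one)
  have hinj : ∀ a, ∃ g : Ω → ℕ, InjOn g {b | r b a} := fun a =>
    countable_iff_exists_injOn.1 (hseg a)
  choose g hg using hinj
  let φ : ℕ ↪ Ω := Infinite.natEmbedding Ω
  let ν : Ω → ℕ := Function.invFun φ
  have hν : ∀ N, ν (φ N) = N := Function.leftInverse_invFun φ.injective
  refine ⟨fun a b => g a b + ν a + ν b, fun A B hA hB N => ?_, fun a N => ⟨φ N, ?_⟩,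
    fun b N => ⟨φ N, ?_⟩⟩
  · -- a point `a` of `A` above infinitely many points of `B`
    obtain ⟨B', hB', hB'c, hB'i⟩ : ∃ B' ⊆ B, B'.Countable ∧ B'.Infinite := by
      have hBi : B.Infinite := fun h => hB h.countable
      refine ⟨range fun n => (hBi.natEmbedding B n : Ω), ?_, countable_range _, ?_⟩
      · rintro _ ⟨n, rfl⟩
        exact (hBi.natEmbedding B n).2
      · exact infinite_range_of_injective fun m n h =>
          (hBi.natEmbedding B).injective (Subtype.ext h)
    have hc : (⋃ b ∈ B', insert b {c | r c b}).Countable :=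
      hB'c.biUnion fun b _ => (hseg b).insert b
    obtain ⟨a, ha, hab⟩ := not_subset.1 fun h => hA (hc.mono h)
    have hlt : B' ⊆ {b | r b a} := fun b hb => by
      rcases trichotomous_of r b a with h | rfl | h
      · exact h
      · exact absurd (mem_biUnion hb (mem_insert _ _)) hab
      · exact absurd (mem_biUnion hb (show a ∈ insert b {c | r c b} from .inr h)) hab
    obtain ⟨_, ⟨b, hb, rfl⟩, hN⟩ := (hB'i.image ((hg a).mono hlt)).exists_gt N
    exact ⟨a, ha, b, hB' hb, by dsimp only; omega⟩
  · simp only [hν]; omega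
  · simp only [hν]; omega

theorem mk_label (hΩ : Cardinal.mk Ω = Cardinal.aleph 1) :
    Cardinal.mk (Label Ω) = Cardinal.aleph 1 := by
  have e : Label Ω ≃ Bool × Ω × Ω :=
    ⟨fun d => ⟨d.side, d.left, d.right⟩, fun p => ⟨p.1, p.2.1, p.2.2⟩, fun _ => rfl, fun _ => rfl⟩
  have h : Cardinal.aleph0 ≤ Cardinal.aleph 1 := Cardinal.aleph0_le_aleph 1
  rw [Cardinal.mk_congr e, Cardinal.mk_prod, Cardinal.mk_prod, hΩ]
  simp only [Cardinal.lift_id]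
  rw [Cardinal.mul_eq_self h, Cardinal.mul_eq_right h _ (by simp)]
  exact (Cardinal.mk_le_aleph0).trans h

theorem exists_isKuleszaSpace :
    ∃ (K : Type) (_ : MetricSpace K) (P₁ : Set K) (P₂ : ℕ → Set K), IsKuleszaSpace K P₁ P₂ := by
  obtain ⟨e, he, h₁, h₂⟩ := exists_unbounded_weight mk_discreteAlephOne
  have : Uncountable DiscreteAlephOne := 
    Cardinal.aleph0_lt_mk_iff.1 (mk_discreteAlephOne ▸ Cardinal.aleph0_lt_aleph_one)
  have : Inhabited DiscreteAlephOne := Classical.inhabited_of_nonempty inferInstance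
  obtain ⟨ψ⟩ := Cardinal.eq.1 ((mk_label mk_discreteAlephOne).trans mk_discreteAlephOne.symm)
  refine ⟨Space (weight e), inferInstance, range (branch _), endPts _, ?_⟩
  exact
    { complete := inferInstance
      zeroDimensional := isZeroDimensional
      coveringDim_le_one := by
        refine coveringDimLE_one_of_union isStronglyZeroDimensional_range_branch
          (B := ⋃ m, endPts _ m) ?_ range_branch_union
        have hsub : ∀ m, endPts (weight e) m ⊆ ⋃ m, endPts _ m := subset_iUnion _
        refine isStronglyZeroDimensional_of_isClosedEmbedding (fun m => inclusion (hsub m))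
          (fun m => ?_) isStronglyZeroDimensional_endPts ?_
        · refine ⟨IsEmbedding.inclusion (hsub m), ?_⟩
          rw [range_inclusion]
          exact (isClosed_endPts m).preimage continuous_subtype_val
        · refine eq_univ_of_forall fun z => ?_
          obtain ⟨m, hm⟩ := mem_iUnion.1 z.2
          exact mem_iUnion.2 ⟨m, ⟨z.1, hm⟩, rfl⟩
      not_coveringDim_le_zero := fun h =>
        not_isStronglyZeroDimensional he ((coveringDimLE_zero_iff _).1 h)
      eq_union := range_branch_union
      homeo := ⟨isEmbedding_branch.toHomeomorph.symm.trans
        (Homeomorph.piCongrRight fun _ => ψ.toHomeomorphOfDiscrete)⟩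
      isClosed := isClosed_endPts
      isNowhereDense := isNowhereDense_endPts h₁ h₂
      stronglyZeroDimensional := isStronglyZeroDimensional_endPts }

end Kulesza

theorem mainTheorem11 :
    (∃ (K : Type) (_ : MetricSpace K) (P₁ : Set K) (P₂ : ℕ → Set K), IsKuleszaSpace K P₁ P₂) ∧
    (∀ (K : Type u) [MetricSpace K] (P₁ : Set K) (P₂ : ℕ → Set K), IsKuleszaSpace K P₁ P₂ →
      ¬ TwoHasWinningStrategy (openCovers K) (openCoversOf P₁)) :=
  ⟨Kulesza.exists_isKuleszaSpace, fun _ _ _ _ hK => hK.not_twoHasWinningStrategy⟩
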